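/- Let $\lambda,\bar\lambda,\mu,\bar\mu,b,d>0$ with $\bar\lambda\bar\mu>\lambda\mu+d$. Let $(T_i)_{i\ge1}$, $(Y_i)_{i\ge1}$, $(\bar T_i)_{i\ge1}$, $(\bar Y_i)_{i\ge1}$ be mutually independent random variables, exponentially distributed with means $1/\lambda$, $\mu$, $1/\bar\lambda$, $\bar\mu$, respectively. Let $N_t=\#\{n\ge1:T_1+\dots+T_n\le t\}$ and $\bar N_t=\#\{n\ge1:\bar T_1+\dots+\bar T_n\le t\}$ be the numbers of claims and of premiums on $[0,t]$, and for each $x\ge0$ let the surplus process $(X^b_t(x))_{t\ge0}$ with initial surplus $x$ and dividends paid at rate $d$ above the threshold $b$ satisfy, almost surely, $$X^b_t(x)=x+\sum_{i=1}^{\bar N_t}\bar Y_i-\sum_{i=1}^{N_t}Y_i-d\int_0^t\mathbf 1\bigl(X^b_s(x)>b\bigr)\,ds,\qquad t\ge0$$ (so a surplus that decreases continuously to $b$ stays at $b$ until the next jump). Let $\tau_b(x)=\inf\{t\ge0:X^b_t(x)<0\}$ and let $\psi(x)=\mathbb P[\tau_b(x)<\infty]$ be the ruin probability. Put $$z_5=\frac{\lambda\mu-\bar\lambda\bar\mu}{\mu\bar\mu(\lambda+\bar\lambda)},\qquad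 p=d\bar\mu-d\mu+\mu\bar\mu(\lambda+\bar\lambda),\qquad D_2=p^2-4d\mu\bar\mu(\bar\lambda\bar\mu-\lambda\mu-d),$$ $$z_7=\frac{-p+\sqrt{D_2}}{2d\mu\bar\mu},\qquad z_8=\frac{-p-\sqrt{D_2}}{2d\mu\bar\mu}.$$ Then $D_2>0$, the numbers $z_5,z_7,z_8$ are negative, and the system of linear equations in the unknowns $C_4,C_5,C_7,C_8$ $$\bigl(\lambda e^{b/\bar\mu}+\bar\lambda\bigr)C_4+\frac{\lambda+\bar\lambda}{\mu+\bar\mu}\bigl(\bar\mu e^{b/\bar\mu}+\mu e^{z_5b}\bigr)C_5+\frac{\bar\lambda e^{z_7b}}{\bar\mu z_7-1}C_7+\frac{\bar\lambda e^{z_8b}}{\bar\mu z_8-1}C_8=\lambda e^{b/\bar\mu},$$ $$\lambda\Bigl(1+\frac{\bar\mu}{\mu}\Bigr)C_4+\frac{\bar\mu(\lambda+\bar\lambda)}{\mu}C_5=\lambda\Bigl(1+\frac{\bar\mu}{\mu}\Bigr),$$ $$C_4+e^{z_5b}C_5-e^{z_7b}C_7-e^{z_8b}C_8=0,$$ $$\lambda\bigl(e^{-b/\mu}-1\bigr)C_4+\frac{\bar\mu(\lambda+\bar\lambda)}{\mu+\bar\mu}\bigl(e^{-b/\mu}-e^{z_5b}\bigr)C_5+\Bigl(\lambda+\bar\lambda+dz_7+\frac{\bar\lambda}{\bar\mu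 z_7-1}\Bigr)e^{z_7b}C_7+\Bigl(\lambda+\bar\lambda+dz_8+\frac{\bar\lambda}{\bar\mu z_8-1}\Bigr)e^{z_8b}C_8=\lambda e^{-b/\mu}$$ has positive determinant, hence a unique solution $(C_4,C_5,C_7,C_8)$. With these constants, $$\psi(x)=C_4+C_5e^{z_5x}\quad\text{for }x\in[0,b],\qquad \psi(x)=C_7e^{z_7x}+C_8e^{z_8x}\quad\text{for }x\in[b,\infty).$$ -/

import Mathlib

open MeasureTheory ProbabilityTheory

noncomputable section

namespace ThresholdRisk

/-- The number of arrivals in `[0, t]` when the successive inter-arrival times are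
`T 0, T 1, …`, so that the `n`-th arrival (counted from `0`) is at `T 0 + ⋯ + T n`. -/
def arrivals (T : ℕ → ℝ) (t : ℝ) : ℕ :=
  Set.ncard {n : ℕ | ∑ i ∈ Finset.range (n + 1), T i ≤ t}

/-- The sum of the sizes of all the jumps that have arrived in `[0, t]`. -/
def totalJumps (T Y : ℕ → ℝ) (t : ℝ) : ℝ :=
  ∑ i ∈ Finset.range (arrivals T t), Y i

/-- The indicator of `{s | X s > b}`, for a path `X`. -/
def aboveThreshold (b : ℝ) (X : ℝ → ℝ) (s : ℝ) : ℝ :=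
  Set.indicator {r : ℝ | b < X r} (fun _ => (1 : ℝ)) s

/-- The path `X` is a surplus path with initial surplus `x`, claims `(T, Y)`, premiums `(T', Y')`,
and dividends paid at rate `d` according to the threshold strategy with threshold `b`:
`X t = x + ∑ premiums - ∑ claims - d ∫₀ᵗ 1(X s > b) ds` for all `t ≥ 0`.
The inequality in the indicator is strict, so that a surplus that has decreased continuously to
the level `b` stays there until the next jump (with `≥` the equation has no solution
beyond such a time). The integrability clause only says that the integral is a genuine one. -/
def IsSurplusPath (b d x : ℝ) (T Y T' Y' : ℕ → ℝ) (X : ℝ → ℝ) : Prop :=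
  ∀ t : ℝ, 0 ≤ t →
    IntervalIntegrable (aboveThreshold b X) volume 0 t ∧
    X t = x + totalJumps T' Y' t - totalJumps T Y t - d * ∫ s in (0 : ℝ)..t, aboveThreshold b X s

/-- The ruin time `inf {t ≥ 0 : X t < 0}`, which is `⊤` when ruin does not occur. -/
def ruinTime (X : ℝ → ℝ) : EReal :=
  sInf ((fun t : ℝ => (t : EReal)) '' {t : ℝ | 0 ≤ t ∧ X t < 0})

/-- The infinite-horizon ruin probability of a surplus process `X`. -/
def ruinProbability {Ω : Type*} [MeasurableSpace Ω] (P : Measure Ω) (X : ℝ → Ω → ℝ) : ℝ :=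
  P.real {ω | ruinTime (fun t => X t ω) < ⊤}

/-- The risk model with stochastic premiums and threshold dividends, without dependence.
Claims have sizes `Y i` (exponential with mean `mu`) and inter-arrival times `T i` (exponential
with rate `lam`), premiums have sizes `Y' i` (exponential with mean `mu'`) and inter-arrival times
`T' i` (exponential with rate `lam'`), and all these random variables are mutually independent.
For every initial surplus `x ≥ 0`, `X x` is the surplus process started at `x`. -/
structure IsModel {Ω : Type*} [MeasurableSpace Ω] (P : Measure Ω) (lam lam' mu mu' b d : ℝ)
    (T Y T' Y' : ℕ → Ω → ℝ) (X : ℝ → ℝ → Ω → ℝ) : Prop where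
  law_claimTime : ∀ i, HasLaw (T i) (expMeasure lam) P
  law_claimSize : ∀ i, HasLaw (Y i) (expMeasure mu⁻¹) P
  law_premiumTime : ∀ i, HasLaw (T' i) (expMeasure lam') P
  law_premiumSize : ∀ i, HasLaw (Y' i) (expMeasure mu'⁻¹) P
  indep : iIndepFun (Sum.elim (Sum.elim T Y) (Sum.elim T' Y')) P
  surplus : ∀ x : ℝ, 0 ≤ x → ∀ᵐ ω ∂P,
    IsSurplusPath b d x (fun i => T i ω) (fun i => Y i ω) (fun i => T' i ω) (fun i => Y' i ω)
      (fun t => X x t ω)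

/-- The exponent `z₅`. -/
def z5 (lam lam' mu mu' : ℝ) : ℝ :=
  (lam * mu - lam' * mu') / (mu * mu' * (lam + lam'))

/-- The discriminant `D₂`. -/
def disc (lam lam' mu mu' d : ℝ) : ℝ :=
  (d * mu' - d * mu + mu * mu' * (lam + lam')) ^ 2
    - 4 * d * mu * mu' * (lam' * mu' - lam * mu - d)

/-- The exponent `z₇`. -/
def z7 (lam lam' mu mu' d : ℝ) : ℝ :=
  (-(d * mu' - d * mu + mu * mu' * (lam + lam')) + Real.sqrt (disc lam lam' mu mu' d))
    / (2 * d * mu * mu')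

/-- The exponent `z₈`. -/
def z8 (lam lam' mu mu' d : ℝ) : ℝ :=
  (-(d * mu' - d * mu + mu * mu' * (lam + lam')) - Real.sqrt (disc lam lam' mu mu' d))
    / (2 * d * mu * mu')

/-- The matrix of the linear system for the unknowns `(C₄, C₅, C₇, C₈)`, where `z₅`, `z₇`, `z₈`
are passed as `u`, `v`, `w`. -/
def coeffMatrix (lam lam' mu mu' b d u v w : ℝ) : Matrix (Fin 4) (Fin 4) ℝ :=
  !![lam * Real.exp (b / mu') + lam',
      (lam + lam') / (mu + mu') * (mu' * Real.exp (b / mu') + mu * Real.exp (u * b)),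
      lam' * Real.exp (v * b) / (mu' * v - 1),
      lam' * Real.exp (w * b) / (mu' * w - 1);
    lam * (1 + mu' / mu),
      mu' * (lam + lam') / mu,
      0,
      0;
    1,
      Real.exp (u * b),
      -Real.exp (v * b),
      -Real.exp (w * b);
    lam * (Real.exp (-b / mu) - 1),
      mu' * (lam + lam') / (mu + mu') * (Real.exp (-b / mu) - Real.exp (u * b)),
      (lam + lam' + d * v + lam' / (mu' * v - 1)) * Real.exp (v * b),
      (lam + lam' + d * w + lam' / (mu' * w - 1)) * Real.exp (w * b)]

/-- The linear system with the exponents of the model put in. -/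
def systemMatrix (lam lam' mu mu' b d : ℝ) : Matrix (Fin 4) (Fin 4) ℝ :=
  coeffMatrix lam lam' mu mu' b d
    (z5 lam lam' mu mu') (z7 lam lam' mu mu' d) (z8 lam lam' mu mu' d)

/-- The right-hand side of the linear system. -/
def systemRHS (lam mu mu' b : ℝ) : Fin 4 → ℝ :=
  ![lam * Real.exp (b / mu'), lam * (1 + mu' / mu), 0, lam * Real.exp (-b / mu)]

end ThresholdRisk

end

/-! Between jumps the surplus moves deterministically: above `b` it falls at rate `d`, and on
reaching `b` it stays there (`level`). This motion keeps it nonnegative, so ruin can only happen at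
a jump. By the lack of memory of competing exponential clocks, the first jump time, the first jump
and the data after it are independent, and the data after it have the original law
(`lintegral_dataLaw_first`). Hence `ψ(x)` is the probability that a Markov chain with kernel
`chain`, started at `x`, ever becomes negative.

A bounded function `φ` that equals `1` on negative surpluses, is harmonic for `chain` on `[0, ∞)`
and tends to `0` at infinity must be `ψ` (`ruin_eq_of_harmonic`). The tool is a maximum principle
(`nonneg_of_superharmonic`): from a bounded range of surpluses, one jump ruins with probability
bounded below, so a negative infimum cannot persist. It gives `φ ≥ 0`, whence `ψ ≤ φ` by induction
on the number of jumps; applied to `ψ - φ`, it gives the converse. No limit theorem is needed: the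
drift condition acts through the signs of the exponents, which make `φ` vanish at infinity, and
through the determinant.

It remains to exhibit `φ`. Averaging exponentials over exponential laws yields exponentials plus
boundary terms. The characteristic equations of `z5`, `z7`, `z8` match the exponentials, and the
linear system cancels the boundary terms at `0` and `b` (`system_equations`, `candidate_harmonic`).
Its determinant factors explicitly into positive terms. -/

namespace ThresholdRisk

/-! ### Signs of the exponents and characteristic equations -/

section Exponents

variable {lam lam' mu mu' b d : ℝ}

lemma disc_pos (hlam : 0 < lam) (hmu : 0 < mu) (hmu' : 0 < mu')
    (hd : 0 < d) : 0 < disc lam lam' mu mu' d := by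
  -- A square plus a positive term: this makes both roots real and distinct.
  have h : disc lam lam' mu mu' d
      = (d * (mu + mu') - mu * mu' * (lam + lam')) ^ 2 + 4 * d * (mu + mu') * mu * mu' * lam := by
    unfold disc; ring
  rw [h]; positivity

lemma z5_neg (hlam : 0 < lam) (hlam' : 0 < lam') (hmu : 0 < mu) (hmu' : 0 < mu')
    (hd : 0 < d) (hdrift : lam * mu + d < lam' * mu') : z5 lam lam' mu mu' < 0 :=
  div_neg_of_neg_of_pos (by linarith) (by positivity)

/-- The coefficient equals `d * mu' + mu * (lam' * mu' - d) + mu * mu' * lam`, and the drift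
condition gives `lam' * mu' > d`. -/
lemma linear_coeff_pos (hlam : 0 < lam) (hmu : 0 < mu) (hmu' : 0 < mu')
    (hd : 0 < d) (hdrift : lam * mu + d < lam' * mu') :
    0 < d * mu' - d * mu + mu * mu' * (lam + lam') := by
  have : 0 < mu * (lam' * mu' - d) := mul_pos hmu (by nlinarith [mul_pos hlam hmu])
  nlinarith [mul_pos hd hmu', mul_pos (mul_pos hmu hmu') hlam]

lemma z8_lt_z7 (hlam : 0 < lam) (hmu : 0 < mu) (hmu' : 0 < mu')
    (hd : 0 < d) : z8 lam lam' mu mu' d < z7 lam lam' mu mu' d := by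
  have := Real.sqrt_pos.2 (disc_pos (lam' := lam') hlam hmu hmu' hd)
  unfold z7 z8
  gcongr
  linarith

/-- The constant coefficient of the quadratic is the net drift above the threshold. Its positivity
forces the square root below the linear coefficient. -/
lemma z7_neg (hlam : 0 < lam) (hmu : 0 < mu) (hmu' : 0 < mu')
    (hd : 0 < d) (hdrift : lam * mu + d < lam' * mu') : z7 lam lam' mu mu' d < 0 := by
  have hp := linear_coeff_pos hlam hmu hmu' hd hdrift
  refine div_neg_of_neg_of_pos ?_ (by positivity)
  have : Real.sqrt (disc lam lam' mu mu' d) < d * mu' - d * mu + mu * mu' * (lam + lam') := by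
    rw [Real.sqrt_lt' hp]
    have : 0 < 4 * d * mu * mu' * (lam' * mu' - lam * mu - d) :=
      mul_pos (by positivity) (by linarith)
    unfold disc; linarith
  linarith

lemma z7_root (hlam : 0 < lam) (hmu : 0 < mu) (hmu' : 0 < mu')
    (hd : 0 < d) :
    d * mu * mu' * z7 lam lam' mu mu' d ^ 2
      + (d * mu' - d * mu + mu * mu' * (lam + lam')) * z7 lam lam' mu mu' d
      + (lam' * mu' - lam * mu - d) = 0 := by
  have h := Real.sq_sqrt (disc_pos (lam' := lam') hlam hmu hmu' hd).le
  have h2 : z7 lam lam' mu mu' d * (2 * d * mu * mu') =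
      -(d * mu' - d * mu + mu * mu' * (lam + lam')) + Real.sqrt (disc lam lam' mu mu' d) := by
    unfold z7; field_simp
  have h3 : (2 * d * mu * mu' * z7 lam lam' mu mu' d
      + (d * mu' - d * mu + mu * mu' * (lam + lam'))) ^ 2 = disc lam lam' mu mu' d := by
    rw [← h]; congr 1; linarith
  -- Multiplying the quadratic by this factor turns it into the completed square minus `disc`.
  have h4 : 4 * d * mu * mu' ≠ 0 := by positivity
  refine mul_left_cancel₀ h4 ?_
  rw [disc] at h3; linear_combination h3

lemma z8_root (hlam : 0 < lam) (hmu : 0 < mu) (hmu' : 0 < mu')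
    (hd : 0 < d) :
    d * mu * mu' * z8 lam lam' mu mu' d ^ 2
      + (d * mu' - d * mu + mu * mu' * (lam + lam')) * z8 lam lam' mu mu' d
      + (lam' * mu' - lam * mu - d) = 0 := by
  have h := Real.sq_sqrt (disc_pos (lam' := lam') hlam hmu hmu' hd).le
  have h2 : z8 lam lam' mu mu' d * (2 * d * mu * mu') =
      -(d * mu' - d * mu + mu * mu' * (lam + lam')) - Real.sqrt (disc lam lam' mu mu' d) := by
    unfold z8; field_simp
  -- The outer sign makes the base equal to the square root itself.
  have h3 : (-(2 * d * mu * mu' * z8 lam lam' mu mu' d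
      + (d * mu' - d * mu + mu * mu' * (lam + lam')))) ^ 2 = disc lam lam' mu mu' d := by
    rw [← h]; congr 1; linarith
  have h4 : 4 * d * mu * mu' ≠ 0 := by positivity
  refine mul_left_cancel₀ h4 ?_
  rw [disc] at h3; linear_combination h3

/-- A root of the quadratic equation is not `-1 / mu`. -/
lemma one_add_mu_mul_ne_zero {z : ℝ} (hlam : 0 < lam) (hmu : 0 < mu) (hmu' : 0 < mu')
    (hz : d * mu * mu' * z ^ 2 + (d * mu' - d * mu + mu * mu' * (lam + lam')) * z
      + (lam' * mu' - lam * mu - d) = 0) : 1 + mu * z ≠ 0 := by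
  intro h
  -- At `-1 / mu` the quadratic takes the value `-lam * (mu + mu')`.
  have : lam * (mu + mu') = 0 := by
    linear_combination (d * mu' * z - d + mu' * (lam + lam')) * h - hz
  exact absurd this (by positivity)

/-- The characteristic equation of the integro-differential equation above the threshold. -/
lemma characteristic_eq {z : ℝ} (hlam : 0 < lam) (hmu : 0 < mu) (hmu' : 0 < mu') (hz0 : z < 0)
    (hz : d * mu * mu' * z ^ 2 + (d * mu' - d * mu + mu * mu' * (lam + lam')) * z
      + (lam' * mu' - lam * mu - d) = 0) :
    lam + lam' + d * z = lam / (1 + mu * z) + lam' / (1 - mu' * z) := by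
  have h1 := one_add_mu_mul_ne_zero hlam hmu hmu' hz
  have h2 : 1 - mu' * z ≠ 0 := by nlinarith [mul_neg_of_pos_of_neg hmu' hz0]
  rw [div_add_div _ _ h1 h2, eq_div_iff (mul_ne_zero h1 h2)]
  -- Cleared of denominators, the equation is `z` times the quadratic; the extra root `0`
  -- corresponds to constant functions.
  linear_combination (-z) * hz

end Exponents

/-! ### Positivity of the determinant -/

section Determinant

variable {lam lam' mu mu' b d u v w : ℝ}

/-- `exp (b / mu')` and `exp (-b / mu)` enter the first and last rows only through multiples of the
second row, so they drop out. The other exponentials act as free symbols, and the identity is purely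
rational. -/
lemma det_coeffMatrix (hmu : 0 < mu) (hmu' : 0 < mu') (hlam : 0 < lam) (hlam' : 0 < lam')
    (hv : v < 0) (hw : w < 0) :
    (coeffMatrix lam lam' mu mu' b d u v w).det =
      mu' * (lam + lam') / mu * (Real.exp (v * b) * Real.exp (w * b)) * (d * (v - w)) *
        ((lam' - lam * mu * Real.exp (u * b) / mu')
          - (1 - lam * (mu + mu') * Real.exp (u * b) / (mu' * (lam + lam'))) * lam'
            * ((1 - mu' * (v + w)) / ((1 - mu' * v) * (1 - mu' * w)))) := by
  have h1 : mu' * v - 1 ≠ 0 := by nlinarith [mul_neg_of_pos_of_neg hmu' hv]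
  have h2 : mu' * w - 1 ≠ 0 := by nlinarith [mul_neg_of_pos_of_neg hmu' hw]
  have h3 : 1 - mu' * v ≠ 0 := by nlinarith [mul_neg_of_pos_of_neg hmu' hv]
  have h4 : 1 - mu' * w ≠ 0 := by nlinarith [mul_neg_of_pos_of_neg hmu' hw]
  have hv' : lam' / (mu' * v - 1) = - (lam' / (1 - mu' * v)) := by
    rw [← div_neg]; congr 1; ring
  have hw' : lam' / (mu' * w - 1) = - (lam' / (1 - mu' * w)) := by
    rw [← div_neg]; congr 1; ring
  have hv'' (x : ℝ) : lam' * x / (mu' * v - 1) = - (lam' * x / (1 - mu' * v)) := by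
    rw [← div_neg]; congr 1; ring
  have hw'' (x : ℝ) : lam' * x / (mu' * w - 1) = - (lam' * x / (1 - mu' * w)) := by
    rw [← div_neg]; congr 1; ring
  unfold coeffMatrix
  rw [hv', hw', hv'', hw'']
  generalize Real.exp (b / mu') = E
  generalize Real.exp (u * b) = U
  generalize Real.exp (v * b) = V
  generalize Real.exp (w * b) = W
  generalize Real.exp (-b / mu) = G
  have hL : lam + lam' ≠ 0 := by positivity
  have hM : mu + mu' ≠ 0 := by positivity
  simp [Matrix.det_succ_row_zero, Fin.sum_univ_succ, Fin.succAbove]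
  field_simp
  ring

/-- Only the sign of the last factor is in doubt. The quotient `q` is below `1` because its
denominator exceeds its numerator by `mu' ^ 2 * v * w`. Its coefficient is positive and at most the
first term, both by `lam * mu < lam' * mu'`. -/
lemma det_coeffMatrix_pos (hmu : 0 < mu) (hmu' : 0 < mu') (hlam : 0 < lam) (hlam' : 0 < lam')
    (hb : 0 < b) (hd : 0 < d) (hdrift : lam * mu + d < lam' * mu')
    (hu : u < 0) (hv : v < 0) (hwv : w < v) :
    0 < (coeffMatrix lam lam' mu mu' b d u v w).det := by
  have hw : w < 0 := hwv.trans hv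
  rw [det_coeffMatrix hmu hmu' hlam hlam' hv hw]
  have hU0 : 0 < Real.exp (u * b) := Real.exp_pos _
  have hU1 : Real.exp (u * b) < 1 := Real.exp_lt_one_iff.2 (mul_neg_of_neg_of_pos hu hb)
  have hv1 := mul_neg_of_pos_of_neg hmu' hv
  have hw1 := mul_neg_of_pos_of_neg hmu' hw
  have hVW := mul_pos (Real.exp_pos (v * b)) (Real.exp_pos (w * b))
  generalize Real.exp (u * b) = U at *
  generalize Real.exp (v * b) * Real.exp (w * b) = VW at *
  refine mul_pos (mul_pos (mul_pos (by positivity) hVW) (mul_pos hd (by linarith))) ?_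
  set q := (1 - mu' * (v + w)) / ((1 - mu' * v) * (1 - mu' * w)) with hq
  have hq1 : q < 1 := by
    rw [hq, div_lt_one (by nlinarith)]
    nlinarith
  have hc : 0 < 1 - lam * (mu + mu') * U / (mu' * (lam + lam')) := by
    rw [sub_pos, div_lt_one (by positivity)]
    have h1 : lam * (mu + mu') * U < lam * (mu + mu') * 1 :=
      mul_lt_mul_of_pos_left hU1 (by positivity)
    nlinarith
  have ha : (1 - lam * (mu + mu') * U / (mu' * (lam + lam'))) * lam'
      ≤ lam' - lam * mu * U / mu' := by
    have : lam' - lam * mu * U / mu'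
        - (1 - lam * (mu + mu') * U / (mu' * (lam + lam'))) * lam'
        = lam * U * (lam' * mu' - lam * mu) / (mu' * (lam + lam')) := by
      field_simp
      ring
    have h2 : 0 ≤ lam * U * (lam' * mu' - lam * mu) / (mu' * (lam + lam')) :=
      div_nonneg (mul_nonneg (by positivity) (by linarith)) (by positivity)
    linarith
  have := mul_lt_mul_of_pos_left hq1 (mul_pos hc hlam')
  linarith

lemma det_systemMatrix_pos (hlam : 0 < lam) (hlam' : 0 < lam') (hmu : 0 < mu) (hmu' : 0 < mu')
    (hb : 0 < b) (hd : 0 < d) (hdrift : lam * mu + d < lam' * mu') :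
    0 < (systemMatrix lam lam' mu mu' b d).det :=
  det_coeffMatrix_pos hmu hmu' hlam hlam' hb hd hdrift
    (z5_neg hlam hlam' hmu hmu' hd hdrift) (z7_neg hlam hmu hmu' hd hdrift)
    (z8_lt_z7 hlam hmu hmu' hd)

end Determinant

/-! ### Splitting and shifting infinite product measures -/

section SequenceMeasures

open Measure

/-- A product measure over a disjoint union of index sets is the product of the two product
measures. -/
lemma map_infinitePi_sum {α β E : Type*} [MeasurableSpace E] (ν : α ⊕ β → Measure E)
    [∀ i, IsProbabilityMeasure (ν i)] :
    (infinitePi ν).map (fun f => (fun i => f (Sum.inl i), fun j => f (Sum.inr j)))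
      = (infinitePi fun i => ν (Sum.inl i)).prod (infinitePi fun j => ν (Sum.inr j)) := by
  -- Gluing the two families gives `infinitePi ν`, as is checked on boxes; splitting then undoes
  -- gluing.
  have key : ((infinitePi fun i => ν (Sum.inl i)).prod (infinitePi fun j => ν (Sum.inr j))).map
      (fun p : (α → E) × (β → E) => fun k : α ⊕ β => Sum.elim p.1 p.2 k) = infinitePi ν := by
    have hm : Measurable fun p : (α → E) × (β → E) => fun k : α ⊕ β => Sum.elim p.1 p.2 k := by
      refine measurable_pi_iff.2 fun k => ?_
      cases k <;> simp <;> fun_prop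
    refine eq_infinitePi _ fun s t ht => ?_
    rw [map_apply hm (MeasurableSet.pi s.countable_toSet fun i _ => ht i)]
    have hpre : (fun p : (α → E) × (β → E) => fun k : α ⊕ β => Sum.elim p.1 p.2 k) ⁻¹'
        (Set.pi s t) = (Set.pi s.toLeft fun i => t (Sum.inl i)) ×ˢ
          (Set.pi s.toRight fun j => t (Sum.inr j)) := by
      ext p
      simp [Set.mem_pi]
    rw [hpre, prod_prod, infinitePi_pi _ fun i _ => ht _, infinitePi_pi _ fun i _ => ht _]
    conv_rhs => rw [← Finset.toLeft_disjSum_toRight (u := s)]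
    rw [Finset.prod_disjSum]
  rw [← key, map_map (by fun_prop)]
  · exact Measure.map_id
  · refine measurable_pi_iff.2 fun k => ?_
    cases k <;> simp <;> fun_prop

/-- The sequence with first term `a` and the terms of `f` after it. -/
def cons {E : Type*} (a : E) (f : ℕ → E) : ℕ → E
  | 0 => a
  | n + 1 => f n

/-- The sequence without its first term. -/
def tail {E : Type*} (f : ℕ → E) : ℕ → E := fun n => f (n + 1)

@[simp] lemma cons_zero {E : Type*} (a : E) (f : ℕ → E) : cons a f 0 = a := rfl

@[simp] lemma cons_succ {E : Type*} (a : E) (f : ℕ → E) (n : ℕ) : cons a f (n + 1) = f n := rfl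

@[simp] lemma tail_cons {E : Type*} (a : E) (f : ℕ → E) : tail (cons a f) = f := rfl

@[simp] lemma tail_apply {E : Type*} (f : ℕ → E) (n : ℕ) : tail f n = f (n + 1) := rfl

@[fun_prop]
lemma measurable_tail {E : Type*} [MeasurableSpace E] : Measurable (tail : (ℕ → E) → ℕ → E) :=
  measurable_pi_iff.2 fun n => measurable_pi_apply (n + 1)

@[fun_prop]
lemma measurable_cons {E α : Type*} [MeasurableSpace E] [MeasurableSpace α] {a : α → E}
    {f : α → ℕ → E} (ha : Measurable a) (hf : Measurable f) :
    Measurable fun x => cons (a x) (f x) := by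
  refine measurable_pi_iff.2 fun n => ?_
  cases n with
  | zero => exact ha
  | succ n => exact (measurable_pi_apply n).comp hf

/-- Putting an independent term in front of an i.i.d. sequence leaves its law unchanged; the
regeneration at jumps rests on this. -/
lemma map_cons_prod {E : Type*} [MeasurableSpace E] (ν : Measure E) [IsProbabilityMeasure ν] :
    (ν.prod (infinitePi fun _ : ℕ => ν)).map (fun p => cons p.1 p.2)
      = infinitePi fun _ : ℕ => ν := by
  refine eq_infinitePi _ fun s t ht => ?_
  classical
  obtain ⟨n, hn⟩ := s.exists_nat_subset_range
  -- Filling in with `univ` extends the box to an initial segment of indices, which always contains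
  -- `0`, so that the head can be split off.
  set t' : ℕ → Set E := fun i => if i ∈ s then t i else Set.univ with ht'
  have hmt' : ∀ i, MeasurableSet (t' i) := fun i => by
    simp only [ht']; split_ifs; exacts [ht i, .univ]
  have hbox : Set.pi (s : Set ℕ) t = Set.pi (Finset.range (n + 1) : Set ℕ) t' := by
    ext f
    simp only [Set.mem_pi, Finset.mem_coe, ht']
    constructor
    · intro h i _
      split_ifs with hi
      exacts [h i hi, trivial]
    · intro h i hi
      have := h i (Finset.range_mono (Nat.le_succ n) (hn hi))
      rwa [if_pos hi] at this
  have hprod : ∏ i ∈ s, ν (t i) = ∏ i ∈ Finset.range (n + 1), ν (t' i) := by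
    rw [← Finset.prod_subset (hn.trans (Finset.range_mono (Nat.le_succ n)))]
    · exact Finset.prod_congr rfl fun i hi => by simp [ht', hi]
    · intro i _ hi
      simp [ht', hi]
  rw [hprod, hbox, map_apply (by fun_prop)
    (MeasurableSet.pi (Finset.countable_toSet _) fun i _ => hmt' i), Finset.prod_range_succ']
  have hpre : (fun p : E × (ℕ → E) => cons p.1 p.2) ⁻¹'
      (Set.pi (Finset.range (n + 1) : Set ℕ) t') =
        t' 0 ×ˢ (Set.pi (Finset.range n : Set ℕ) fun i => t' (i + 1)) := by
    ext p
    simp only [Set.mem_preimage, Set.mem_pi, Finset.coe_range, Set.mem_Iio, Set.mem_prod]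
    constructor
    · exact fun h => ⟨h 0 (Nat.succ_pos n), fun i hi => h (i + 1) (Nat.succ_lt_succ hi)⟩
    · rintro ⟨h0, h⟩ i hi
      cases i with
      | zero => exact h0
      | succ i => exact h i (Nat.lt_of_succ_lt_succ hi)
  rw [hpre, prod_prod, infinitePi_pi _ fun i _ => hmt' _, mul_comm]

lemma lintegral_infinitePi_cons {E : Type*} [MeasurableSpace E] (ν : Measure E)
    [IsProbabilityMeasure ν] {f : (ℕ → E) → ENNReal} (hf : Measurable f) :
    ∫⁻ s, f s ∂(infinitePi fun _ : ℕ => ν)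
      = ∫⁻ a, ∫⁻ s, f (cons a s) ∂(infinitePi fun _ : ℕ => ν) ∂ν := by
  conv_lhs => rw [← map_cons_prod ν]
  rw [lintegral_map hf (by fun_prop), lintegral_prod _ (by fun_prop)]

end SequenceMeasures

/-! ### The exponential law and its lack of memory -/

section Exponential

variable {r a : ℝ}

lemma lintegral_expMeasure (r : ℝ) {f : ℝ → ENNReal} (hf : Measurable f) :
    ∫⁻ t, f t ∂(expMeasure r)
      = ∫⁻ t in Set.Ici 0, ENNReal.ofReal (r * Real.exp (-(r * t))) * f t := by
  have hm : Measurable (gammaPDF 1 r) := (measurable_exponentialPDFReal r).ennreal_ofReal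
  rw [expMeasure, gammaMeasure, lintegral_withDensity_eq_lintegral_mul _ hm hf,
    ← lintegral_indicator measurableSet_Ici]
  refine lintegral_congr fun t => ?_
  have h : gammaPDF 1 r t = exponentialPDF r t := rfl
  rw [Pi.mul_apply, h, exponentialPDF_eq]
  by_cases ht : 0 ≤ t
  · rw [if_pos ht, Set.indicator_of_mem (Set.mem_Ici.2 ht)]
  · rw [if_neg ht, Set.indicator_of_notMem (by simpa using ht)]; simp

lemma expMeasure_absolutelyContinuous (r : ℝ) : expMeasure r ≪ volume :=
  withDensity_absolutelyContinuous _ _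

instance (r : ℝ) : NullSingletonClass (expMeasure r) :=
  ⟨fun _ => expMeasure_absolutelyContinuous r (measure_singleton _)⟩

lemma ae_pos_expMeasure (r : ℝ) : ∀ᵐ t ∂(expMeasure r), 0 < t := by
  have h : expMeasure r (Set.Iio 0) = 0 := by
    rw [← lintegral_indicator_one measurableSet_Iio,
      lintegral_expMeasure r (measurable_one.indicator measurableSet_Iio)]
    refine setLIntegral_eq_zero measurableSet_Ici fun t ht => ?_
    simp [Set.indicator_of_notMem (show t ∉ Set.Iio 0 by simpa using ht)]
  have h' : expMeasure r (Set.Iic 0) = 0 := by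
    rw [← measure_congr (Iio_ae_eq_Iic (μ := expMeasure r) (a := 0)), h]
  rw [ae_iff]
  simpa [← Set.Iic_def] using h'

/-- Weighting an exponential law by an exponential changes its rate. -/
lemma lintegral_expMeasure_mul_exp (hr : 0 < r) (ha : 0 < a) {f : ℝ → ENNReal}
    (hf : Measurable f) :
    ∫⁻ t, ENNReal.ofReal (Real.exp (-(a * t))) * f t ∂(expMeasure r)
      = ENNReal.ofReal (r / (r + a)) * ∫⁻ t, f t ∂(expMeasure (r + a)) := by
  rw [lintegral_expMeasure r (by fun_prop), lintegral_expMeasure (r + a) hf,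
    ← lintegral_const_mul _ (by fun_prop)]
  refine lintegral_congr fun t => ?_
  rw [← mul_assoc, ← mul_assoc, ← ENNReal.ofReal_mul (by positivity),
    ← ENNReal.ofReal_mul (by positivity)]
  congr 2
  rw [mul_assoc, ← Real.exp_add, ← mul_assoc, div_mul_cancel₀ _ (by positivity)]
  congr 2; ring

/-- The lack of memory of the exponential law. -/
lemma lintegral_expMeasure_indicator_Ici (ha : 0 ≤ a) {f : ℝ → ENNReal}
    (hf : Measurable f) :
    ∫⁻ t, (Set.Ici a).indicator (fun t => f (t - a)) t ∂(expMeasure r)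
      = ENNReal.ofReal (Real.exp (-(r * a))) * ∫⁻ t, f t ∂(expMeasure r) := by
  have hfa : Measurable fun t => f (t - a) := hf.comp (measurable_id.sub_const a)
  rw [lintegral_expMeasure r (hfa.indicator measurableSet_Ici), lintegral_expMeasure r hf,
    ← lintegral_const_mul _ (by fun_prop), ← lintegral_indicator measurableSet_Ici,
    ← lintegral_indicator measurableSet_Ici, ← lintegral_add_right_eq_self _ a]
  refine lintegral_congr fun t => ?_
  by_cases ht : 0 ≤ t
  · rw [Set.indicator_of_mem (Set.mem_Ici.2 (by linarith)),
      Set.indicator_of_mem (Set.mem_Ici.2 (by linarith)),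
      Set.indicator_of_mem (Set.mem_Ici.2 ht), add_sub_cancel_right, ← mul_assoc,
      ← ENNReal.ofReal_mul (by positivity)]
    congr 2
    rw [mul_left_comm, ← Real.exp_add]
    congr 2; ring_nf
  · rw [Set.indicator_of_notMem (s := Set.Ici 0) (a := t) (by simpa using ht)]
    by_cases h2 : t + a ∈ Set.Ici (0 : ℝ)
    · rw [Set.indicator_of_mem h2, Set.indicator_of_notMem (by simpa using ht), mul_zero]
    · rw [Set.indicator_of_notMem h2]

/-- The lack of memory, for a set `I` which is either `[0, ∞)` or `(0, ∞)`. -/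
lemma lintegral_expMeasure_residual (ha : 0 ≤ a) {I : Set ℝ}
    (hpos : ∀ x, 0 < x → x ∈ I) (hneg : ∀ x, x < 0 → x ∉ I) {f : ℝ → ENNReal}
    (hf : Measurable f) :
    ∫⁻ t, I.indicator 1 (t - a) * f (t - a) ∂(expMeasure r)
      = ENNReal.ofReal (Real.exp (-(r * a))) * ∫⁻ t, f t ∂(expMeasure r) := by
  rw [← lintegral_expMeasure_indicator_Ici ha hf]
  -- The only point where the choice of `I` matters is null.
  have hne : ∀ᵐ t ∂(expMeasure r), t ≠ a := by
    rw [ae_iff]; simp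
  refine lintegral_congr_ae (hne.mono fun t ht => ?_)
  rcases lt_or_gt_of_ne ht with h | h
  · simp only
    rw [Set.indicator_of_notMem (hneg _ (by linarith)),
      Set.indicator_of_notMem (by simpa using h), zero_mul]
  · simp only
    rw [Set.indicator_of_mem (hpos _ (by linarith)),
      Set.indicator_of_mem (Set.mem_Ici.2 h.le), Pi.one_apply, one_mul]

end Exponential

/-! ### Regeneration at the first jump -/

section OneStep

open Measure

/-- The law of a sequence of independent exponential variables of rate `r`. -/
noncomputable def seqLaw (r : ℝ) : Measure (ℕ → ℝ) := infinitePi fun _ : ℕ => expMeasure r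

lemma isProbabilityMeasure_seqLaw {r : ℝ} (hr : 0 < r) : IsProbabilityMeasure (seqLaw r) := by
  have := isProbabilityMeasure_expMeasure hr
  unfold seqLaw; infer_instance

lemma lintegral_seqLaw_cons {r : ℝ} (hr : 0 < r) {f : (ℕ → ℝ) → ENNReal} (hf : Measurable f) :
    ∫⁻ s, f s ∂(seqLaw r) = ∫⁻ a, ∫⁻ s, f (cons a s) ∂(seqLaw r) ∂(expMeasure r) := by
  have := isProbabilityMeasure_expMeasure hr
  exact lintegral_infinitePi_cons _ hf

/-- The law of the inter-arrival times (with rate `r`) and the sizes (with rate `q`) of a compound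
Poisson process with exponential jumps. -/
noncomputable def streamLaw (r q : ℝ) : Measure ((ℕ → ℝ) × (ℕ → ℝ)) := (seqLaw r).prod (seqLaw q)

lemma isProbabilityMeasure_streamLaw {r q : ℝ} (hr : 0 < r) (hq : 0 < q) :
    IsProbabilityMeasure (streamLaw r q) := by
  have := isProbabilityMeasure_seqLaw hr
  have := isProbabilityMeasure_seqLaw hq
  unfold streamLaw; infer_instance

lemma lintegral_streamLaw_cons {r q : ℝ} (hr : 0 < r) (hq : 0 < q)
    {f : (ℕ → ℝ) × (ℕ → ℝ) → ENNReal} (hf : Measurable f) :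
    ∫⁻ p, f p ∂(streamLaw r q)
      = ∫⁻ t, ∫⁻ y, ∫⁻ p, f (cons t p.1, cons y p.2) ∂(streamLaw r q)
          ∂(expMeasure q) ∂(expMeasure r) := by
  have := isProbabilityMeasure_expMeasure hr
  have := isProbabilityMeasure_expMeasure hq
  have := isProbabilityMeasure_seqLaw hr
  have := isProbabilityMeasure_seqLaw hq
  unfold streamLaw
  rw [lintegral_prod _ hf.aemeasurable, lintegral_seqLaw_cons hr (by fun_prop)]
  refine lintegral_congr fun t => ?_
  have h1 : ∀ T, ∫⁻ Y, f (cons t T, Y) ∂(seqLaw q)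
      = ∫⁻ y, ∫⁻ Y, f (cons t T, cons y Y) ∂(seqLaw q) ∂(expMeasure q) := fun T =>
    lintegral_seqLaw_cons hq (by fun_prop)
  simp_rw [h1]
  rw [lintegral_lintegral_swap (by fun_prop)]
  refine lintegral_congr fun y => ?_
  rw [lintegral_prod _ (by fun_prop)]

/-- Lack of memory of the head, with the rest of the stream as an independent parameter: given
survival past `a`, the residual stream is a fresh one. -/
lemma lintegral_streamLaw_residual {r q a : ℝ} (hr : 0 < r) (hq : 0 < q) (ha : 0 ≤ a) {I : Set ℝ}
    (hI : MeasurableSet I) (hpos : ∀ x, 0 < x → x ∈ I) (hneg : ∀ x, x < 0 → x ∉ I)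
    {g : (ℕ → ℝ) × (ℕ → ℝ) → ENNReal} (hg : Measurable g) :
    ∫⁻ p, I.indicator 1 (p.1 0 - a) * g (cons (p.1 0 - a) (tail p.1), p.2) ∂(streamLaw r q)
      = ENNReal.ofReal (Real.exp (-(r * a))) * ∫⁻ p, g p ∂(streamLaw r q) := by
  have := isProbabilityMeasure_expMeasure hr
  have := isProbabilityMeasure_seqLaw hr
  have := isProbabilityMeasure_seqLaw hq
  have hI1 : Measurable (I.indicator (1 : ℝ → ENNReal)) := measurable_one.indicator hI
  unfold streamLaw
  rw [lintegral_prod _ (by fun_prop), lintegral_prod _ hg.aemeasurable,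
    lintegral_seqLaw_cons hr (by fun_prop), lintegral_seqLaw_cons hr (by fun_prop),
    ← lintegral_expMeasure_residual ha hpos hneg (by fun_prop)]
  refine lintegral_congr fun t => ?_
  simp only [cons_zero, tail_cons]
  rw [← lintegral_const_mul _ (by fun_prop)]
  refine lintegral_congr fun T => ?_
  rw [lintegral_const_mul _ (by fun_prop)]

/-- The first arrival in a stream, when it comes before the first arrival in another, independent
stream. -/
lemma lintegral_streamLaw_first {r q r' q' : ℝ} (hr : 0 < r) (hq : 0 < q) (hr' : 0 < r')
    (hq' : 0 < q') {I : Set ℝ} (hI : MeasurableSet I) (hpos : ∀ x, 0 < x → x ∈ I)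
    (hneg : ∀ x, x < 0 → x ∉ I)
    {f : ℝ × ℝ × ((ℕ → ℝ) × (ℕ → ℝ)) × ((ℕ → ℝ) × (ℕ → ℝ)) → ENNReal} (hf : Measurable f) :
    ∫⁻ p, ∫⁻ p', I.indicator 1 (p'.1 0 - p.1 0) * f (p.1 0, p.2 0, (tail p.1, tail p.2),
        (cons (p'.1 0 - p.1 0) (tail p'.1), p'.2)) ∂(streamLaw r' q') ∂(streamLaw r q)
      = ENNReal.ofReal (r / (r + r')) * ∫⁻ t, ∫⁻ y, ∫⁻ p, ∫⁻ p', f (t, y, p, p')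
          ∂(streamLaw r' q') ∂(streamLaw r q) ∂(expMeasure q) ∂(expMeasure (r + r')) := by
  have := isProbabilityMeasure_expMeasure hr
  have := isProbabilityMeasure_expMeasure hq
  have := isProbabilityMeasure_streamLaw hr hq
  have := isProbabilityMeasure_streamLaw hr' hq'
  have hI1 : Measurable (I.indicator (1 : ℝ → ENNReal)) := measurable_one.indicator hI
  -- Given a first arrival at `t`, the other stream has none before `t` with probability `exp (-(r'
  -- * t))`. Weighting `expMeasure r` by this yields `expMeasure (r + r')` and the factor `r / (r +
  -- r')`.
  rw [lintegral_streamLaw_cons hr hq (by fun_prop),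
    ← lintegral_expMeasure_mul_exp hr hr' (by fun_prop)]
  refine lintegral_congr_ae ((ae_pos_expMeasure r).mono fun t ht => ?_)
  simp only [cons_zero, tail_cons]
  rw [← lintegral_const_mul _ (by fun_prop)]
  refine lintegral_congr fun y => ?_
  rw [← lintegral_const_mul _ (by fun_prop)]
  refine lintegral_congr fun p => ?_
  exact lintegral_streamLaw_residual (g := fun p' => f (t, y, p, p')) hr' hq' ht.le hI hpos hneg
    (by fun_prop)

/-- The inter-arrival times and sizes of the claims, and those of the premiums. -/
abbrev Data : Type := ((ℕ → ℝ) × (ℕ → ℝ)) × ((ℕ → ℝ) × (ℕ → ℝ))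

/-- The law of the data of the risk model. -/
noncomputable def dataLaw (lam lam' mu mu' : ℝ) : Measure Data :=
  (streamLaw lam mu⁻¹).prod (streamLaw lam' mu'⁻¹)

/-- The time of the first jump of the surplus. -/
noncomputable def firstTime (s : Data) : ℝ := min (s.1.1 0) (s.2.1 0)

/-- The first jump of the surplus. -/
noncomputable def firstJump (s : Data) : ℝ :=
  if s.1.1 0 ≤ s.2.1 0 then -s.1.2 0 else s.2.2 0

/-- The data of the risk process after its first jump. -/
noncomputable def advance (s : Data) : Data :=
  if s.1.1 0 ≤ s.2.1 0 then
    ((tail s.1.1, tail s.1.2), (cons (s.2.1 0 - s.1.1 0) (tail s.2.1), s.2.2))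
  else ((cons (s.1.1 0 - s.2.1 0) (tail s.1.1), s.1.2), (tail s.2.1, tail s.2.2))

/-- The law of a jump of the surplus. -/
noncomputable def jumpLaw (lam lam' mu mu' : ℝ) : Measure ℝ :=
  ENNReal.ofReal (lam / (lam + lam')) • (expMeasure mu⁻¹).map (fun y => -y)
    + ENNReal.ofReal (lam' / (lam + lam')) • expMeasure mu'⁻¹

variable {lam lam' mu mu' : ℝ}

lemma isProbabilityMeasure_dataLaw (hlam : 0 < lam) (hlam' : 0 < lam') (hmu : 0 < mu)
    (hmu' : 0 < mu') : IsProbabilityMeasure (dataLaw lam lam' mu mu') := by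
  have := isProbabilityMeasure_streamLaw hlam (inv_pos.2 hmu)
  have := isProbabilityMeasure_streamLaw hlam' (inv_pos.2 hmu')
  unfold dataLaw; infer_instance

lemma isProbabilityMeasure_jumpLaw (hlam : 0 < lam) (hlam' : 0 < lam') (hmu : 0 < mu)
    (hmu' : 0 < mu') : IsProbabilityMeasure (jumpLaw lam lam' mu mu') := by
  have := isProbabilityMeasure_expMeasure (inv_pos.2 hmu)
  have := isProbabilityMeasure_expMeasure (inv_pos.2 hmu')
  have : IsProbabilityMeasure ((expMeasure mu⁻¹).map (fun y => -y)) :=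
    isProbabilityMeasure_map (by fun_prop)
  constructor
  simp only [jumpLaw, Measure.add_apply, Measure.smul_apply, measure_univ, smul_eq_mul, mul_one]
  rw [← ENNReal.ofReal_add (by positivity) (by positivity), ← add_div, div_self (by positivity),
    ENNReal.ofReal_one]

lemma lintegral_jumpLaw {f : ℝ → ENNReal} (hf : Measurable f) :
    ∫⁻ j, f j ∂(jumpLaw lam lam' mu mu')
      = ENNReal.ofReal (lam / (lam + lam')) * ∫⁻ y, f (-y) ∂(expMeasure mu⁻¹)
        + ENNReal.ofReal (lam' / (lam + lam')) * ∫⁻ y, f y ∂(expMeasure mu'⁻¹) := by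
  rw [jumpLaw, lintegral_add_measure, lintegral_smul_measure, lintegral_smul_measure,
    lintegral_map hf (by fun_prop), smul_eq_mul, smul_eq_mul]

lemma measurableSet_claimFirst : MeasurableSet {s : Data | s.1.1 0 ≤ s.2.1 0} :=
  measurableSet_le (by fun_prop) (by fun_prop)

@[fun_prop]
lemma measurable_firstTime : Measurable firstTime := by
  unfold firstTime; fun_prop

@[fun_prop]
lemma measurable_firstJump : Measurable firstJump :=
  Measurable.ite measurableSet_claimFirst (by fun_prop) (by fun_prop)

@[fun_prop]
lemma measurable_advance : Measurable advance :=
  Measurable.ite measurableSet_claimFirst (by fun_prop) (by fun_prop)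

/-- The time of the first jump, the first jump, and the data after it are independent. -/
lemma lintegral_dataLaw_first (hlam : 0 < lam) (hlam' : 0 < lam') (hmu : 0 < mu) (hmu' : 0 < mu')
    {f : ℝ × ℝ × Data → ENNReal} (hf : Measurable f) :
    ∫⁻ s, f (firstTime s, firstJump s, advance s) ∂(dataLaw lam lam' mu mu')
      = ∫⁻ t, ∫⁻ j, ∫⁻ s, f (t, j, s) ∂(dataLaw lam lam' mu mu')
          ∂(jumpLaw lam lam' mu mu') ∂(expMeasure (lam + lam')) := by
  have := isProbabilityMeasure_streamLaw hlam (inv_pos.2 hmu)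
  have := isProbabilityMeasure_streamLaw hlam' (inv_pos.2 hmu')
  have := isProbabilityMeasure_dataLaw hlam hlam' hmu hmu'
  have := isProbabilityMeasure_expMeasure (inv_pos.2 hmu)
  have := isProbabilityMeasure_expMeasure (inv_pos.2 hmu')
  have hIci : Measurable ((Set.Ici (0 : ℝ)).indicator (1 : ℝ → ENNReal)) :=
    measurable_one.indicator measurableSet_Ici
  have hIoi : Measurable ((Set.Ioi (0 : ℝ)).indicator (1 : ℝ → ENNReal)) :=
    measurable_one.indicator measurableSet_Ioi
  -- Ties count as claims, hence the closed half-line in one term and the open one in the other.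
  have hsplit : ∀ s : Data, f (firstTime s, firstJump s, advance s)
      = (Set.Ici (0 : ℝ)).indicator 1 (s.2.1 0 - s.1.1 0) * f (s.1.1 0, -s.1.2 0,
          (tail s.1.1, tail s.1.2), (cons (s.2.1 0 - s.1.1 0) (tail s.2.1), s.2.2))
        + (Set.Ioi (0 : ℝ)).indicator 1 (s.1.1 0 - s.2.1 0) * f (s.2.1 0, s.2.2 0,
          (cons (s.1.1 0 - s.2.1 0) (tail s.1.1), s.1.2), (tail s.2.1, tail s.2.2)) := by
    intro s
    by_cases h : s.1.1 0 ≤ s.2.1 0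
    · rw [Set.indicator_of_mem (Set.mem_Ici.2 (by linarith)),
        Set.indicator_of_notMem (by simpa using h)]
      simp [firstTime, firstJump, advance, h]
    · rw [Set.indicator_of_notMem (by simpa using h),
        Set.indicator_of_mem (Set.mem_Ioi.2 (by linarith))]
      simp [firstTime, firstJump, advance, h, (not_le.1 h).le]
  simp_rw [hsplit]
  rw [lintegral_add_left (by fun_prop)]
  have h1 : ∀ t, ∫⁻ j, ∫⁻ s, f (t, j, s) ∂(dataLaw lam lam' mu mu') ∂(jumpLaw lam lam' mu mu')
      = ENNReal.ofReal (lam / (lam + lam'))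
          * ∫⁻ y, ∫⁻ s, f (t, -y, s) ∂(dataLaw lam lam' mu mu') ∂(expMeasure mu⁻¹)
        + ENNReal.ofReal (lam' / (lam + lam'))
          * ∫⁻ y, ∫⁻ s, f (t, y, s) ∂(dataLaw lam lam' mu mu') ∂(expMeasure mu'⁻¹) := fun t =>
    lintegral_jumpLaw (by fun_prop)
  simp_rw [h1]
  rw [lintegral_add_left (by fun_prop), lintegral_const_mul _ (by fun_prop),
    lintegral_const_mul _ (by fun_prop)]
  congr 1
  · rw [dataLaw, lintegral_prod _ (by fun_prop)]
    refine (lintegral_streamLaw_first (f := fun z => f (z.1, -z.2.1, z.2.2)) hlam (inv_pos.2 hmu)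
      hlam' (inv_pos.2 hmu') measurableSet_Ici (fun x hx => hx.le) (fun x hx => not_le.2 hx)
      (by fun_prop)).trans ?_
    congr 1
    refine lintegral_congr fun t => lintegral_congr fun y => ?_
    rw [lintegral_prod _ (by fun_prop)]
  · rw [dataLaw, lintegral_prod_symm _ (by fun_prop)]
    refine (lintegral_streamLaw_first (f := fun z => f (z.1, z.2.1, z.2.2.2, z.2.2.1)) hlam'
      (inv_pos.2 hmu') hlam (inv_pos.2 hmu) measurableSet_Ioi (fun x hx => hx)
      (fun x hx => not_lt.2 (le_of_lt hx)) (by fun_prop)).trans ?_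
    rw [add_comm lam' lam]
    congr 1
    refine lintegral_congr fun t => lintegral_congr fun y => ?_
    rw [lintegral_prod_symm _ (by fun_prop)]

/-- This is the third marginal of the independence statement. It lets almost sure properties pass to
the data after any number of jumps. -/
lemma measurePreserving_advance (hlam : 0 < lam) (hlam' : 0 < lam') (hmu : 0 < mu)
    (hmu' : 0 < mu') :
    MeasurePreserving advance (dataLaw lam lam' mu mu') (dataLaw lam lam' mu mu') := by
  have := isProbabilityMeasure_expMeasure (add_pos hlam hlam')
  have := isProbabilityMeasure_jumpLaw hlam hlam' hmu hmu'
  refine ⟨measurable_advance, Measure.ext_of_lintegral _ fun f hf => ?_⟩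
  rw [lintegral_map hf measurable_advance]
  refine (lintegral_dataLaw_first (f := fun z => f z.2.2) hlam hlam' hmu hmu'
    (by fun_prop)).trans ?_
  simp

end OneStep

/-! ### Deterministic motion between jumps -/

section Path

/-- The surplus at time `t` when no jump occurs in `[0, t]` and the initial surplus is `x`. -/
noncomputable def level (b d x t : ℝ) : ℝ := x - d * max 0 (min t ((x - b) / d))

variable {b d x t : ℝ}

/-- The total decrease is at most `max 0 (x - b)`, so the motion between jumps cannot cause ruin. -/
lemma level_nonneg (hb : 0 ≤ b) (hd : 0 < d) (hx : 0 ≤ x) : 0 ≤ level b d x t := by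
  have h : d * max 0 (min t ((x - b) / d)) ≤ max 0 (x - b) := by
    rw [mul_max_of_nonneg _ _ hd.le, mul_zero]
    refine max_le_max le_rfl ?_
    calc d * min t ((x - b) / d) ≤ d * ((x - b) / d) :=
          mul_le_mul_of_nonneg_left (min_le_right _ _) hd.le
      _ = x - b := mul_div_cancel₀ _ hd.ne'
  have h2 : max 0 (x - b) ≤ x := max_le hx (by linarith)
  unfold level; linarith

lemma level_le (hd : 0 < d) : level b d x t ≤ x := by
  have := mul_nonneg hd.le (le_max_left 0 (min t ((x - b) / d)))
  unfold level; linarith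

lemma level_of_le (hd : 0 < d) (hx : x ≤ b) : level b d x t = x := by
  have : min t ((x - b) / d) ≤ 0 :=
    (min_le_right _ _).trans (div_nonpos_of_nonpos_of_nonneg (by linarith) hd.le)
  rw [level, max_eq_left this]; ring

lemma integral_eq_of_eq_indicator {f : ℝ → ℝ} {c : ℝ} (ht : 0 ≤ t)
    (hf : ∀ s ∈ Set.Ioo 0 t, f s = (Set.Iio c).indicator (fun _ => 1) s) :
    ∫ s in (0 : ℝ)..t, f s = max 0 (min t c) := by
  rw [intervalIntegral.integral_of_le ht, integral_Ioc_eq_integral_Ioo,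
    setIntegral_congr_fun measurableSet_Ioo hf, setIntegral_indicator measurableSet_Iio,
    Set.Ioo_inter_Iio, setIntegral_const, smul_eq_mul, mul_one, Real.volume_real_Ioo,
    sub_zero, max_comm]

lemma aboveThreshold_mem (b : ℝ) (X : ℝ → ℝ) (s : ℝ) :
    0 ≤ aboveThreshold b X s ∧ aboveThreshold b X s ≤ 1 := by
  unfold aboveThreshold
  by_cases h : s ∈ {r | b < X r}
  · simp [Set.indicator_of_mem h]
  · simp [Set.indicator_of_notMem h]

/-- Until the first jump, the surplus decreases at rate `d` as long as it is above `b`, and then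
stays at `b`. -/
lemma integral_aboveThreshold {X : ℝ → ℝ} {τ : ℝ} (hd : 0 < d)
    (hint : IntervalIntegrable (aboveThreshold b X) volume 0 τ)
    (hX : ∀ t, 0 ≤ t → t < τ → X t = x - d * ∫ s in (0 : ℝ)..t, aboveThreshold b X s)
    (ht : 0 ≤ t) (htτ : t ≤ τ) :
    ∫ s in (0 : ℝ)..t, aboveThreshold b X s = max 0 (min t ((x - b) / d)) := by
  have hint' : ∀ u v, 0 ≤ u → u ≤ v → v ≤ τ →
      IntervalIntegrable (aboveThreshold b X) volume u v := fun u v hu huv hv =>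
    hint.mono_set (by
      rw [Set.uIcc_of_le huv, Set.uIcc_of_le (hu.trans (huv.trans hv))]
      exact Set.Icc_subset_Icc hu hv)
  -- The indicator lies in `[0, 1]`, so the path is nonincreasing and falls at rate at most `d`. The
  -- latter keeps it above `b` before time `(x - b) / d`; if that time is nonnegative, the value
  -- there is then exactly `b`, and monotonicity bounds the path by `b` afterwards.
  have hanti : ∀ u v, 0 ≤ u → u ≤ v → v < τ → X v ≤ X u := by
    intro u v hu huv hv
    rw [hX u hu (huv.trans_lt hv), hX v (hu.trans huv) hv,
      ← intervalIntegral.integral_add_adjacent_intervals (hint' 0 u le_rfl hu (huv.trans hv.le))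
        (hint' u v hu huv hv.le)]
    have : 0 ≤ ∫ s in u..v, aboveThreshold b X s :=
      intervalIntegral.integral_nonneg huv fun s _ => (aboveThreshold_mem b X s).1
    nlinarith [mul_nonneg hd.le this]
  have hlow : ∀ u, 0 ≤ u → u < τ → x - d * u ≤ X u := by
    intro u hu huτ
    rw [hX u hu huτ]
    have : ∫ s in (0 : ℝ)..u, aboveThreshold b X s ≤ ∫ _ in (0 : ℝ)..u, (1 : ℝ) :=
      intervalIntegral.integral_mono_on hu (hint' 0 u le_rfl hu huτ.le) (by simp)
        fun s _ => (aboveThreshold_mem b X s).2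
    have h2 : ∫ _ in (0 : ℝ)..u, (1 : ℝ) = u := by simp
    rw [h2] at this
    nlinarith [mul_le_mul_of_nonneg_left this hd.le]
  have hone : ∀ u, 0 ≤ u → u < τ → u < (x - b) / d → b < X u := by
    intro u hu huτ h
    rw [lt_div_iff₀ hd] at h
    linarith [hlow u hu huτ]
  have hzero : ∀ u, 0 ≤ u → u < τ → (x - b) / d ≤ u → X u ≤ b := by
    intro u hu huτ h
    rcases le_total ((x - b) / d) 0 with hc | hc
    · have hx : x ≤ b := by
        by_contra! hlt
        exact absurd (div_pos (sub_pos.2 hlt) hd) (not_lt.2 hc)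
      have h0 := hX 0 le_rfl (hu.trans_lt huτ)
      rw [intervalIntegral.integral_same, mul_zero, sub_zero] at h0
      linarith [hanti 0 u le_rfl hu huτ]
    · refine (hanti _ u hc h huτ).trans ?_
      rw [hX _ hc (h.trans_lt huτ), integral_eq_of_eq_indicator (c := (x - b) / d) hc]
      · rw [min_self, max_eq_right hc, mul_div_cancel₀ _ hd.ne']; linarith
      · intro s hs
        rw [Set.indicator_of_mem (Set.mem_Iio.2 hs.2)]
        exact Set.indicator_of_mem
          (show s ∈ {r | b < X r} from hone s hs.1.le (hs.2.trans_le (h.trans huτ.le)) hs.2) _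
  -- Only the open interval matters, so the formula also holds at `t = τ`, where `hX` is not
  -- available.
  refine integral_eq_of_eq_indicator ht fun s hs => ?_
  have hsτ := hs.2.trans_le htτ
  by_cases h : s < (x - b) / d
  · rw [Set.indicator_of_mem (Set.mem_Iio.2 h)]
    exact Set.indicator_of_mem (show s ∈ {r | b < X r} from hone s hs.1.le hsτ h) _
  · rw [Set.indicator_of_notMem (by simpa using h)]
    exact Set.indicator_of_notMem
      (show s ∉ {r | b < X r} from not_lt.2 (hzero s hs.1.le hsτ (not_lt.1 h))) _

end Path

/-! ### Arrival counts under a shift of time -/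

section Arrivals

variable {T Y : ℕ → ℝ} {t : ℝ}

lemma arrivals_eq_zero (hT : ∀ i, 0 < T i) (ht : t < T 0) : arrivals T t = 0 := by
  have : {n : ℕ | ∑ i ∈ Finset.range (n + 1), T i ≤ t} = ∅ := by
    refine Set.eq_empty_of_forall_notMem fun n hn => ?_
    have := Finset.single_le_sum (f := T) (fun i _ => (hT i).le)
      (Finset.mem_range.2 (Nat.succ_pos n))
    exact absurd (this.trans hn) (not_le.2 ht)
  rw [arrivals, this, Set.ncard_empty]

/-- Finiteness is essential: `Set.ncard` gives an infinite set the value `0`, which would break the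
`+ 1`. -/
lemma arrivals_tail (hfin : {n : ℕ | ∑ i ∈ Finset.range (n + 1), T i ≤ t}.Finite)
    (ht : T 0 ≤ t) : arrivals T t = arrivals (tail T) (t - T 0) + 1 := by
  have hset : {n : ℕ | ∑ i ∈ Finset.range (n + 1), T i ≤ t}
      = insert 0 (Nat.succ '' {n : ℕ | ∑ i ∈ Finset.range (n + 1), tail T i ≤ t - T 0}) := by
    ext n
    cases n with
    | zero => simpa using ht
    | succ n =>
      simp only [Set.mem_ofPred_eq, Set.mem_insert_iff, Set.mem_image, Nat.succ_eq_add_one,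
        add_left_inj, exists_eq_right, Nat.add_eq_zero_iff, one_ne_zero, and_false, false_or]
      rw [Finset.sum_range_succ' T (n + 1), le_sub_iff_add_le]
      rfl
  rw [arrivals, hset, Set.ncard_insert_of_notMem (by simp)
    ((Set.Finite.subset (by rwa [← hset]) (Set.subset_insert _ _))),
    Set.ncard_image_of_injective _ Nat.succ_injective, arrivals]

/-- Shortening the first waiting time by `a` moves every arrival time by `a`, so the two index sets
coincide. -/
lemma arrivals_residual (T : ℕ → ℝ) (a t : ℝ) :
    arrivals (cons (T 0 - a) (tail T)) t = arrivals T (a + t) := by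
  unfold arrivals
  congr 1
  ext n
  simp only [Set.mem_ofPred_eq]
  rw [Finset.sum_range_succ', Finset.sum_range_succ' T]
  simp only [cons_succ, cons_zero, tail_apply]
  constructor <;> intro h <;> linarith

lemma totalJumps_eq_zero (hT : ∀ i, 0 < T i) (ht : t < T 0) : totalJumps T Y t = 0 := by
  rw [totalJumps, arrivals_eq_zero hT ht, Finset.range_zero, Finset.sum_empty]

lemma totalJumps_tail
    (hfin : {n : ℕ | ∑ i ∈ Finset.range (n + 1), T i ≤ T 0 + t}.Finite) (ht : 0 ≤ t) :
    totalJumps T Y (T 0 + t) = totalJumps (tail T) (tail Y) t + Y 0 := by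
  rw [totalJumps, arrivals_tail hfin (by linarith), add_sub_cancel_left, Finset.sum_range_succ']
  rfl

lemma totalJumps_residual (T Y : ℕ → ℝ) (a t : ℝ) :
    totalJumps (cons (T 0 - a) (tail T)) Y t = totalJumps T Y (a + t) := by
  rw [totalJumps, arrivals_residual, totalJumps]

end Arrivals

/-! ### From ruin of the path to ruin at a jump -/

section Ruin

/-- The properties which almost all data have. -/
structure Regular (s : Data) : Prop where
  claim_pos : ∀ i, 0 < s.1.1 i
  premium_pos : ∀ i, 0 < s.2.1 i
  ne : s.1.1 0 ≠ s.2.1 0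
  claim_finite : ∀ t, {n : ℕ | ∑ i ∈ Finset.range (n + 1), s.1.1 i ≤ t}.Finite
  premium_finite : ∀ t, {n : ℕ | ∑ i ∈ Finset.range (n + 1), s.2.1 i ≤ t}.Finite

/-- The transition of the surplus together with the future data at the first jump. -/
noncomputable def step (b d : ℝ) (p : ℝ × Data) : ℝ × Data :=
  (level b d p.1 (firstTime p.2) + firstJump p.2, advance p.2)

/-- The event that the surplus is negative after one of the first `n` jumps. -/
def ruinSet (b d : ℝ) : ℕ → Set (ℝ × Data)
  | 0 => {p | p.1 < 0}
  | n + 1 => {p | p.1 < 0} ∪ step b d ⁻¹' ruinSet b d n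

variable {b d x t : ℝ} {s : Data} {X : ℝ → ℝ}

lemma Regular.firstTime_pos (hs : Regular s) : 0 < firstTime s :=
  lt_min (hs.claim_pos 0) (hs.premium_pos 0)

lemma surplus_before_jump (hd : 0 < d) (hs : Regular s)
    (hX : IsSurplusPath b d x s.1.1 s.1.2 s.2.1 s.2.2 X) (ht : 0 ≤ t) (htτ : t < firstTime s) :
    X t = level b d x t := by
  have hX' : ∀ t, 0 ≤ t → t < firstTime s →
      X t = x - d * ∫ s in (0 : ℝ)..t, aboveThreshold b X s := fun t ht htτ => by
    rw [(hX t ht).2, totalJumps_eq_zero hs.premium_pos (htτ.trans_le (min_le_right _ _)),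
      totalJumps_eq_zero hs.claim_pos (htτ.trans_le (min_le_left _ _))]
    ring
  rw [hX' t ht htτ, integral_aboveThreshold hd (hX _ hs.firstTime_pos.le).1 hX' ht htτ.le, level]

/-- The surplus after the first jump is the surplus process of the data after it. -/
lemma surplus_after_jump (hd : 0 < d) (hs : Regular s)
    (hX : IsSurplusPath b d x s.1.1 s.1.2 s.2.1 s.2.2 X) :
    IsSurplusPath b d (level b d x (firstTime s) + firstJump s) (advance s).1.1 (advance s).1.2
      (advance s).2.1 (advance s).2.2 (fun t => X (firstTime s + t)) := by
  have hτ := hs.firstTime_pos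
  have hX' : ∀ t, 0 ≤ t → t < firstTime s →
      X t = x - d * ∫ s in (0 : ℝ)..t, aboveThreshold b X s := fun t ht htτ => by
    rw [(hX t ht).2, totalJumps_eq_zero hs.premium_pos (htτ.trans_le (min_le_right _ _)),
      totalJumps_eq_zero hs.claim_pos (htτ.trans_le (min_le_left _ _))]
    ring
  intro t ht
  obtain ⟨hint, hXt⟩ := hX (firstTime s + t) (by linarith)
  have hab : aboveThreshold b (fun t => X (firstTime s + t))
      = fun r => aboveThreshold b X (firstTime s + r) := rfl
  have hint0 := (hX _ hτ.le).1
  have hint1 : IntervalIntegrable (aboveThreshold b X) volume (firstTime s) (firstTime s + t) :=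
    hint0.symm.trans hint
  refine ⟨?_, ?_⟩
  · rw [hab]
    simpa using hint1.comp_add_left (firstTime s)
  · have hsplit : ∫ r in (0 : ℝ)..t, aboveThreshold b (fun t => X (firstTime s + t)) r
        = (∫ r in (0 : ℝ)..firstTime s + t, aboveThreshold b X r)
          - ∫ r in (0 : ℝ)..firstTime s, aboveThreshold b X r := by
      rw [hab, intervalIntegral.integral_comp_add_left (aboveThreshold b X) (firstTime s), add_zero,
        intervalIntegral.integral_interval_sub_left hint hint0]
    -- The stream that jumps first loses its first term; the other keeps its sizes and only has its
    -- waiting time shortened.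
    have hjumps : totalJumps s.2.1 s.2.2 (firstTime s + t) - totalJumps s.1.1 s.1.2 (firstTime s + t)
        = firstJump s + totalJumps (advance s).2.1 (advance s).2.2 t
          - totalJumps (advance s).1.1 (advance s).1.2 t := by
      rcases lt_or_gt_of_ne hs.ne with h | h
      · rw [show firstTime s = s.1.1 0 from min_eq_left h.le, firstJump, if_pos h.le, advance,
          if_pos h.le, totalJumps_tail (hs.claim_finite _) ht, totalJumps_residual]
        ring
      · rw [show firstTime s = s.2.1 0 from min_eq_right h.le, firstJump, if_neg (not_le.2 h),
          advance, if_neg (not_le.2 h), totalJumps_tail (hs.premium_finite _) ht,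
          totalJumps_residual]
        ring
    rw [hsplit]
    beta_reduce
    rw [hXt, integral_aboveThreshold hd hint0 hX' hτ.le le_rfl, level]
    linear_combination hjumps

lemma arrivals_advance (hs : Regular s) (ht : 0 ≤ t) :
    arrivals s.1.1 (firstTime s + t) + arrivals s.2.1 (firstTime s + t)
      = arrivals (advance s).1.1 t + arrivals (advance s).2.1 t + 1 := by
  rcases lt_or_gt_of_ne hs.ne with h | h
  · rw [show firstTime s = s.1.1 0 from min_eq_left h.le, advance, if_pos h.le,
      arrivals_tail (hs.claim_finite _) (by linarith), add_sub_cancel_left]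
    simp only [arrivals_residual]
    ring
  · rw [show firstTime s = s.2.1 0 from min_eq_right h.le, advance, if_neg (not_le.2 h),
      arrivals_tail (T := s.2.1) (hs.premium_finite _) (by linarith), add_sub_cancel_left]
    simp only [arrivals_residual]
    ring

lemma surplus_zero (hs : Regular s) (hX : IsSurplusPath b d x s.1.1 s.1.2 s.2.1 s.2.2 X) :
    X 0 = x := by
  rw [(hX 0 le_rfl).2, totalJumps_eq_zero hs.premium_pos (hs.premium_pos 0),
    totalJumps_eq_zero hs.claim_pos (hs.claim_pos 0)]
  simp

/-- The induction is on the number of jumps up to the time of the negative value, which drops by one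
at each passage to the path after its first jump. -/
lemma mem_ruinSet_of_ruin (hb : 0 ≤ b) (hd : 0 < d) (N : ℕ) (hs : ∀ n, Regular (advance^[n] s))
    (hx : 0 ≤ x) (hX : IsSurplusPath b d x s.1.1 s.1.2 s.2.1 s.2.2 X) (ht : 0 ≤ t)
    (hN : arrivals s.1.1 t + arrivals s.2.1 t = N) (hneg : X t < 0) :
    ∃ n, (x, s) ∈ ruinSet b d n := by
  induction N generalizing x s X t with
  | zero | succ N ih =>
    have hs0 : Regular s := hs 0
    rcases lt_or_ge t (firstTime s) with htτ | htτ
    · rw [surplus_before_jump hd hs0 hX ht htτ] at hneg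
      exact absurd (level_nonneg hb hd hx) (not_le.2 hneg)
    obtain ⟨u, rfl⟩ : ∃ u, t = firstTime s + u := ⟨t - firstTime s, by ring⟩
    have hu : 0 ≤ u := by linarith
    rw [arrivals_advance hs0 hu] at hN
    -- For `N = 0` the count of arrivals contradicts `hN`. Otherwise the surplus is negative at the
    -- first jump, or the path after it inherits the negative value.
    first
    | omega
    | rcases lt_or_ge (level b d x (firstTime s) + firstJump s) 0 with h1 | h1
      · exact ⟨1, Or.inr h1⟩
      · obtain ⟨n, hn⟩ := ih (s := advance s) (fun n => hs (n + 1)) h1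
          (surplus_after_jump hd hs0 hX) hu (by omega) hneg
        exact ⟨n + 1, Or.inr hn⟩

lemma ruin_of_mem_ruinSet (hd : 0 < d) (n : ℕ) (hs : ∀ n, Regular (advance^[n] s))
    (hx : 0 ≤ x) (hX : IsSurplusPath b d x s.1.1 s.1.2 s.2.1 s.2.2 X)
    (hn : (x, s) ∈ ruinSet b d n) : ∃ t, 0 ≤ t ∧ X t < 0 := by
  induction n generalizing x s X with
  | zero => exact absurd hx (not_le.2 hn)
  | succ n ih =>
    rcases hn with hn | hn
    · exact absurd hx (not_le.2 hn)
    have hs0 : Regular s := hs 0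
    have hX1 := surplus_after_jump hd hs0 hX
    rcases lt_or_ge (level b d x (firstTime s) + firstJump s) 0 with h1 | h1
    -- The `+ 0` matches the time origin of the shifted path.
    · refine ⟨firstTime s + 0, by simpa using hs0.firstTime_pos.le, ?_⟩
      rw [← surplus_zero (s := advance s) (hs 1) hX1] at h1
      exact h1
    · obtain ⟨t, ht, hneg⟩ := ih (s := advance s) (fun n => hs (n + 1)) h1 hX1 hn
      exact ⟨firstTime s + t, by linarith [hs0.firstTime_pos], hneg⟩

lemma ruinTime_lt_top_iff : ruinTime X < ⊤ ↔ ∃ t, 0 ≤ t ∧ X t < 0 := by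
  rw [ruinTime, sInf_lt_iff]
  constructor
  · rintro ⟨_, ⟨t, ht, rfl⟩, _⟩
    exact ⟨t, ht⟩
  · rintro ⟨t, ht⟩
    exact ⟨t, ⟨t, ht, rfl⟩, EReal.coe_lt_top t⟩

lemma ruinTime_lt_top_iff_mem_ruinSet (hb : 0 ≤ b) (hd : 0 < d)
    (hs : ∀ n, Regular (advance^[n] s)) (hx : 0 ≤ x)
    (hX : IsSurplusPath b d x s.1.1 s.1.2 s.2.1 s.2.2 X) :
    ruinTime X < ⊤ ↔ ∃ n, (x, s) ∈ ruinSet b d n := by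
  rw [ruinTime_lt_top_iff]
  constructor
  · rintro ⟨t, ht, hneg⟩
    exact mem_ruinSet_of_ruin hb hd _ hs hx hX ht rfl hneg
  · rintro ⟨n, hn⟩
    exact ruin_of_mem_ruinSet hd n hs hx hX hn

end Ruin

/-! ### Almost sure regularity of the data -/

section AlmostSure

open Measure

variable {r : ℝ}

lemma lintegral_exp_neg_sum (hr : 0 < r) (n : ℕ) :
    ∫⁻ T : ℕ → ℝ, ENNReal.ofReal (Real.exp (-∑ i ∈ Finset.range n, T i)) ∂(seqLaw r)
      = ENNReal.ofReal (r / (r + 1)) ^ n := by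
  have := isProbabilityMeasure_seqLaw hr
  have := isProbabilityMeasure_expMeasure (show 0 < r + 1 by positivity)
  induction n with
  | zero => simp
  | succ n ih =>
    rw [lintegral_seqLaw_cons hr (by fun_prop)]
    have h : ∀ (a : ℝ) (T : ℕ → ℝ),
        ENNReal.ofReal (Real.exp (-∑ i ∈ Finset.range (n + 1), cons a T i))
          = ENNReal.ofReal (Real.exp (-(1 * a)))
            * ENNReal.ofReal (Real.exp (-∑ i ∈ Finset.range n, T i)) := fun a T => by
      rw [← ENNReal.ofReal_mul (by positivity), ← Real.exp_add, Finset.sum_range_succ']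
      congr 2
      simp only [cons_succ, cons_zero]
      ring
    simp_rw [h]
    have h2 : ∀ a : ℝ, ∫⁻ T : ℕ → ℝ, ENNReal.ofReal (Real.exp (-(1 * a)))
            * ENNReal.ofReal (Real.exp (-∑ i ∈ Finset.range n, T i)) ∂(seqLaw r)
          = ENNReal.ofReal (Real.exp (-(1 * a))) * ENNReal.ofReal (r / (r + 1)) ^ n := fun a => by
      rw [lintegral_const_mul _ (by fun_prop), ih]
    simp_rw [h2]
    rw [lintegral_expMeasure_mul_exp hr one_pos measurable_const, lintegral_const, measure_univ,
      mul_one, pow_succ']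

/-- The arrival times of a Poisson process do not accumulate. -/
lemma ae_finite_arrivals (hr : 0 < r) :
    ∀ᵐ T ∂(seqLaw r), ∀ t : ℝ, {n : ℕ | ∑ i ∈ Finset.range (n + 1), T i ≤ t}.Finite := by
  -- The expected sum of `exp (-arrival time)` is a geometric series. The sum is therefore almost
  -- surely finite, and only finitely many terms can reach `exp (-t)`.
  have hfin : ∫⁻ T : ℕ → ℝ, ∑' n : ℕ,
      ENNReal.ofReal (Real.exp (-∑ i ∈ Finset.range (n + 1), T i)) ∂(seqLaw r) ≠ ⊤ := by
    rw [lintegral_tsum fun n => by fun_prop]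
    simp_rw [lintegral_exp_neg_sum hr, pow_succ']
    rw [ENNReal.tsum_mul_left, ENNReal.tsum_geometric]
    refine ENNReal.mul_ne_top ENNReal.ofReal_ne_top (ENNReal.inv_ne_top.2 ?_)
    rw [ne_eq, tsub_eq_zero_iff_le, not_le, ENNReal.ofReal_lt_one, div_lt_one (by positivity)]
    linarith
  refine (ae_lt_top' (by fun_prop) hfin).mono fun T hT t => ?_
  refine (ENNReal.finite_const_le_of_tsum_ne_top hT.ne
    (ε := ENNReal.ofReal (Real.exp (-t))) (by simpa using Real.exp_pos _)).subset fun n hn => ?_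
  exact ENNReal.ofReal_le_ofReal (Real.exp_le_exp.2 (neg_le_neg hn))

lemma ae_pos_seqLaw (hr : 0 < r) : ∀ᵐ T ∂(seqLaw r), ∀ i, 0 < T i := by
  have := isProbabilityMeasure_expMeasure hr
  refine ae_all_iff.2 fun i => ?_
  exact (measurePreserving_eval_infinitePi (fun _ : ℕ => expMeasure r) i).quasiMeasurePreserving.ae
    (ae_pos_expMeasure r)

variable {lam lam' mu mu' : ℝ}

lemma ae_ne_dataLaw (hlam : 0 < lam) (hlam' : 0 < lam') (hmu : 0 < mu) (hmu' : 0 < mu') :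
    ∀ᵐ s ∂(dataLaw lam lam' mu mu'), s.1.1 0 ≠ s.2.1 0 := by
  have := isProbabilityMeasure_expMeasure hlam'
  have := isProbabilityMeasure_streamLaw hlam (inv_pos.2 hmu)
  have := isProbabilityMeasure_streamLaw hlam' (inv_pos.2 hmu')
  have := isProbabilityMeasure_seqLaw (inv_pos.2 hmu')
  have hm : MeasurableSet {s : Data | s.1.1 0 ≠ s.2.1 0} :=
    (measurableSet_eq_fun (by fun_prop) (by fun_prop)).compl
  refine (ae_prod_mem_iff_ae_ae_mem hm).2 (Filter.Eventually.of_forall fun p => ?_)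
  have h0 : ∀ᵐ t ∂(expMeasure lam'), p.1 0 ≠ t := by
    rw [ae_iff]; simp
  have h1 : ∀ᵐ T ∂(seqLaw lam'), p.1 0 ≠ T 0 :=
    (measurePreserving_eval_infinitePi
      (fun _ : ℕ => expMeasure lam') 0).quasiMeasurePreserving.ae h0
  exact quasiMeasurePreserving_fst.ae h1

lemma ae_regular (hlam : 0 < lam) (hlam' : 0 < lam') (hmu : 0 < mu) (hmu' : 0 < mu') :
    ∀ᵐ s ∂(dataLaw lam lam' mu mu'), ∀ n, Regular (advance^[n] s) := by
  have := isProbabilityMeasure_streamLaw hlam (inv_pos.2 hmu)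
  have := isProbabilityMeasure_streamLaw hlam' (inv_pos.2 hmu')
  have := isProbabilityMeasure_seqLaw (inv_pos.2 hmu)
  have := isProbabilityMeasure_seqLaw (inv_pos.2 hmu')
  refine ae_all_iff.2 fun n => ?_
  refine ((measurePreserving_advance hlam hlam' hmu hmu').iterate n).quasiMeasurePreserving.ae ?_
  have hc : ∀ {p : (ℕ → ℝ) → Prop}, (∀ᵐ T ∂(seqLaw lam), p T) →
      ∀ᵐ s ∂(dataLaw lam lam' mu mu'), p s.1.1 := fun h =>
    quasiMeasurePreserving_fst.ae (p := fun q : (ℕ → ℝ) × (ℕ → ℝ) => _)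
      (quasiMeasurePreserving_fst.ae h)
  have hp : ∀ {p : (ℕ → ℝ) → Prop}, (∀ᵐ T ∂(seqLaw lam'), p T) →
      ∀ᵐ s ∂(dataLaw lam lam' mu mu'), p s.2.1 := fun h =>
    quasiMeasurePreserving_snd.ae (p := fun q : (ℕ → ℝ) × (ℕ → ℝ) => _)
      (quasiMeasurePreserving_fst.ae h)
  filter_upwards [hc (ae_pos_seqLaw hlam), hp (ae_pos_seqLaw hlam'),
    ae_ne_dataLaw hlam hlam' hmu hmu', hc (ae_finite_arrivals hlam),
    hp (ae_finite_arrivals hlam')] with s h1 h2 h3 h4 h5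
  exact ⟨h1, h2, h3, h4, h5⟩

end AlmostSure

/-! ### Transfer from the model to the law of the data -/

section Law

variable {Ω : Type*} [MeasurableSpace Ω] {P : Measure Ω} {lam lam' mu mu' b d : ℝ}
  {T Y T' Y' : ℕ → Ω → ℝ} {X : ℝ → ℝ → Ω → ℝ}

/-- Mutual independence gives a single product over four copies of `ℕ`; splitting it at the outer
sum and then at both inner sums gives the nested product. -/
lemma IsModel.hasLaw_data (hX : IsModel P lam lam' mu mu' b d T Y T' Y' X)
    (hlam : 0 < lam) (hlam' : 0 < lam') (hmu : 0 < mu) (hmu' : 0 < mu') :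
    HasLaw (fun ω => (((fun i => T i ω), (fun i => Y i ω)), ((fun i => T' i ω), (fun i => Y' i ω))))
      (dataLaw lam lam' mu mu') P := by
  have := isProbabilityMeasure_expMeasure hlam
  have := isProbabilityMeasure_expMeasure hlam'
  have := isProbabilityMeasure_expMeasure (inv_pos.2 hmu)
  have := isProbabilityMeasure_expMeasure (inv_pos.2 hmu')
  set ν : (ℕ ⊕ ℕ) ⊕ (ℕ ⊕ ℕ) → Measure ℝ :=
    Sum.elim (Sum.elim (fun _ => expMeasure lam) (fun _ => expMeasure mu⁻¹))
      (Sum.elim (fun _ => expMeasure lam') (fun _ => expMeasure mu'⁻¹)) with hν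
  have hνp : ∀ i, IsProbabilityMeasure (ν i) := by
    rintro ((i | i) | (i | i)) <;> simp only [hν, Sum.elim_inl, Sum.elim_inr] <;> infer_instance
  have hlaw : ∀ i, HasLaw (Sum.elim (Sum.elim T Y) (Sum.elim T' Y') i) (ν i) P := by
    rintro ((i | i) | (i | i))
    exacts [hX.law_claimTime i, hX.law_claimSize i, hX.law_premiumTime i, hX.law_premiumSize i]
  have h := hX.indep.hasLaw_infinitePi hlaw (aemeasurable_pi_iff.2 fun i => (hlaw i).aemeasurable)
  have h1 : MeasurePreserving
      (fun f : (ℕ ⊕ ℕ) ⊕ (ℕ ⊕ ℕ) → ℝ => (fun i => f (Sum.inl i), fun j => f (Sum.inr j)))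
      (Measure.infinitePi ν) _ := ⟨by fun_prop, map_infinitePi_sum ν⟩
  have h2 : MeasurePreserving
      (fun f : ℕ ⊕ ℕ → ℝ => (fun i => f (Sum.inl i), fun j => f (Sum.inr j)))
      (Measure.infinitePi fun i => ν (Sum.inl i)) _ := ⟨by fun_prop, map_infinitePi_sum _⟩
  have h3 : MeasurePreserving
      (fun f : ℕ ⊕ ℕ → ℝ => (fun i => f (Sum.inl i), fun j => f (Sum.inr j)))
      (Measure.infinitePi fun i => ν (Sum.inr i)) _ := ⟨by fun_prop, map_infinitePi_sum _⟩
  exact (((h2.prod h3).comp h1).comp_hasLaw h)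

@[fun_prop]
lemma measurable_level : Measurable fun p : ℝ × ℝ => level b d p.1 p.2 := by
  unfold level; fun_prop

@[fun_prop]
lemma measurable_step : Measurable (step b d) :=
  Measurable.prodMk ((measurable_level.comp (by fun_prop :
    Measurable fun p : ℝ × Data => (p.1, firstTime p.2))).add (by fun_prop)) (by fun_prop)

lemma measurableSet_ruinSet (n : ℕ) : MeasurableSet (ruinSet b d n) := by
  have h0 : MeasurableSet {p : ℝ × Data | p.1 < 0} :=
    measurableSet_lt (by fun_prop) measurable_const
  induction n with
  | zero => exact h0
  | succ n ih => exact h0.union (measurable_step ih)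

/-- The event of ruin, as a set of pairs of an initial surplus and data. -/
def ruinEvent (b d : ℝ) : Set (ℝ × Data) := ⋃ n, ruinSet b d n

lemma measurableSet_ruinEvent : MeasurableSet (ruinEvent b d) :=
  MeasurableSet.iUnion measurableSet_ruinSet

lemma IsModel.ruinProbability_eq (hX : IsModel P lam lam' mu mu' b d T Y T' Y' X)
    (hlam : 0 < lam) (hlam' : 0 < lam') (hmu : 0 < mu) (hmu' : 0 < mu') (hb : 0 ≤ b) (hd : 0 < d)
    {x : ℝ} (hx : 0 ≤ x) :
    ruinProbability P (X x) = (dataLaw lam lam' mu mu').real (Prod.mk x ⁻¹' ruinEvent b d) := by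
  have hlaw := hX.hasLaw_data hlam hlam' hmu hmu'
  have hreg : ∀ᵐ ω ∂P, ∀ n, Regular (advance^[n] (((fun i => T i ω), (fun i => Y i ω)),
      ((fun i => T' i ω), (fun i => Y' i ω)))) :=
    ae_of_ae_map hlaw.aemeasurable (by
      rw [hlaw.map_eq]; exact ae_regular hlam hlam' hmu hmu')
  rw [ruinProbability, ← hlaw.map_eq, measureReal_def, measureReal_def,
    Measure.map_apply_of_aemeasurable hlaw.aemeasurable
      (measurable_prodMk_left measurableSet_ruinEvent)]
  congr 1
  -- The event of ruin in `Ω` need not be measurable; almost sure agreement with the preimage of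
  -- `ruinEvent` suffices.
  refine measure_congr ?_
  filter_upwards [hreg, hX.surplus x hx] with ω h1 h2
  have := ruinTime_lt_top_iff_mem_ruinSet hb hd h1 hx h2
  refine propext ?_
  simp only [ruinEvent]
  refine this.trans ?_
  exact (Set.mem_iUnion (s := ruinSet b d)).symm

end Law

/-! ### The embedded chain and the maximum principle -/

section Chain

variable {lam lam' mu mu' b d : ℝ}

/-- The law of the surplus just after its first jump, from the initial surplus `x`. -/
noncomputable def chain (lam lam' mu mu' b d x : ℝ) : Measure ℝ :=
  ((expMeasure (lam + lam')).prod (jumpLaw lam lam' mu mu')).map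
    (fun p => level b d x p.1 + p.2)

lemma measurable_level_add (b d x : ℝ) :
    Measurable fun p : ℝ × ℝ => level b d x p.1 + p.2 :=
  (measurable_level.comp (by fun_prop : Measurable fun p : ℝ × ℝ => (x, p.1))).add measurable_snd

lemma isProbabilityMeasure_chain (hlam : 0 < lam) (hlam' : 0 < lam') (hmu : 0 < mu)
    (hmu' : 0 < mu') (x : ℝ) : IsProbabilityMeasure (chain lam lam' mu mu' b d x) := by
  have := isProbabilityMeasure_expMeasure (add_pos hlam hlam')
  have := isProbabilityMeasure_jumpLaw hlam hlam' hmu hmu'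
  exact Measure.isProbabilityMeasure_map (measurable_level_add b d x).aemeasurable

/-- The Markov property: the surplus after the jump is independent of the data that drive the
future. -/
lemma dataLaw_step (hlam : 0 < lam) (hlam' : 0 < lam') (hmu : 0 < mu) (hmu' : 0 < mu')
    {R : Set (ℝ × Data)} (hR : MeasurableSet R) (x : ℝ) :
    dataLaw lam lam' mu mu' {s | step b d (x, s) ∈ R}
      = ∫⁻ z, dataLaw lam lam' mu mu' (Prod.mk z ⁻¹' R) ∂(chain lam lam' mu mu' b d x) := by
  have := isProbabilityMeasure_dataLaw hlam hlam' hmu hmu'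
  have := isProbabilityMeasure_expMeasure (add_pos hlam hlam')
  have := isProbabilityMeasure_jumpLaw hlam hlam' hmu hmu'
  have hlev := measurable_level_add b d x
  have hR1 : Measurable (R.indicator (1 : ℝ × Data → ENNReal)) := measurable_one.indicator hR
  have hm : Measurable fun z => dataLaw lam lam' mu mu' (Prod.mk z ⁻¹' R) :=
    measurable_measure_prodMk_left hR
  have hf : Measurable fun z : ℝ × ℝ × Data =>
      R.indicator (1 : ℝ × Data → ENNReal) (level b d x z.1 + z.2.1, z.2.2) :=
    hR1.comp ((hlev.comp (by fun_prop : Measurable fun z : ℝ × ℝ × Data => (z.1, z.2.1))).prodMk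
      (by fun_prop))
  have hms : MeasurableSet {s | step b d (x, s) ∈ R} :=
    measurable_prodMk_left (measurable_step hR)
  have hm' : Measurable fun p : ℝ × ℝ =>
      dataLaw lam lam' mu mu' (Prod.mk (level b d x p.1 + p.2) ⁻¹' R) := hm.comp hlev
  rw [chain, lintegral_map hm hlev, lintegral_prod _ hm'.aemeasurable,
    ← lintegral_indicator_one hms]
  refine (lintegral_dataLaw_first hlam hlam' hmu hmu' hf).trans ?_
  refine lintegral_congr fun t => lintegral_congr fun j => ?_
  rw [← lintegral_indicator_one (measurable_prodMk_left hR)]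
  rfl

lemma expMeasure_Ici {r a : ℝ} (hr : 0 < r) (ha : 0 ≤ a) :
    expMeasure r (Set.Ici a) = ENNReal.ofReal (Real.exp (-(r * a))) := by
  have := isProbabilityMeasure_expMeasure hr
  have h := lintegral_expMeasure_indicator_Ici (r := r) ha (f := 1) measurable_one
  simp only [Pi.one_apply, lintegral_one, measure_univ, mul_one] at h
  rw [← h, ← lintegral_indicator_one measurableSet_Ici]
  rfl

/-- From a surplus in `[0, K]`, the next jump leads to ruin with a probability bounded from
below. -/
lemma exists_le_chain_neg (hlam : 0 < lam) (hlam' : 0 < lam') (hmu : 0 < mu) (hmu' : 0 < mu')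
    (hd : 0 < d) {K : ℝ} (hK : 0 ≤ K) :
    ∃ δ : ℝ, 0 < δ ∧ ∀ x ≤ K, δ ≤ (chain lam lam' mu mu' b d x).real (Set.Iio 0) := by
  have := isProbabilityMeasure_expMeasure (add_pos hlam hlam')
  have := isProbabilityMeasure_jumpLaw hlam hlam' hmu hmu'
  -- From a level of at most `K`, a claim of at least `K + 1` leads below zero.
  refine ⟨(jumpLaw lam lam' mu mu').real (Set.Iic (-(K + 1))), ?_, fun x hx => ?_⟩
  · refine ENNReal.toReal_pos (ne_of_gt ?_) (measure_ne_top _ _)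
    rw [jumpLaw, Measure.add_apply, Measure.smul_apply,
      Measure.map_apply (by fun_prop) measurableSet_Iic]
    have hpre : (fun y : ℝ => -y) ⁻¹' Set.Iic (-(K + 1)) = Set.Ici (K + 1) := by
      ext y; simp
    rw [hpre, expMeasure_Ici (inv_pos.2 hmu) (by linarith), smul_eq_mul]
    refine lt_of_lt_of_le ?_ le_self_add
    exact ENNReal.mul_pos (by simpa using by positivity) (by simpa using Real.exp_pos _)
  · have := isProbabilityMeasure_chain (b := b) (d := d) hlam hlam' hmu hmu' x
    refine ENNReal.toReal_mono (measure_ne_top _ _) ?_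
    rw [chain, Measure.map_apply (measurable_level_add b d x) measurableSet_Iio]
    calc jumpLaw lam lam' mu mu' (Set.Iic (-(K + 1)))
        = ((expMeasure (lam + lam')).prod (jumpLaw lam lam' mu mu'))
            (Set.univ ×ˢ Set.Iic (-(K + 1))) := by
          rw [Measure.prod_prod, measure_univ, one_mul]
      _ ≤ _ := by
          refine measure_mono fun p hp => ?_
          have h1 : p.2 ≤ -(K + 1) := hp.2
          have h2 := level_le (b := b) (x := x) (t := p.1) hd
          exact Set.mem_preimage.2 (Set.mem_Iio.2 (by linarith))

/-- A maximum principle: a bounded superharmonic function which is nonnegative after ruin and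
asymptotically nonnegative is nonnegative. -/
lemma nonneg_of_superharmonic (hlam : 0 < lam) (hlam' : 0 < lam') (hmu : 0 < mu) (hmu' : 0 < mu')
    (hd : 0 < d) {g : ℝ → ℝ} (hg : Measurable g) {M : ℝ} (hM : ∀ x, |g x| ≤ M)
    (hneg : ∀ x < 0, 0 ≤ g x)
    (hsuper : ∀ x, 0 ≤ x → ∫ z, g z ∂(chain lam lam' mu mu' b d x) ≤ g x)
    (hinf : ∀ ε > 0, ∃ K, ∀ x ≥ K, -ε ≤ g x) (x : ℝ) : 0 ≤ g x := by
  have hbdd : BddBelow (Set.range g) := ⟨-M, by rintro _ ⟨x, rfl⟩; exact (abs_le.1 (hM x)).1⟩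
  set m := sInf (Set.range g) with hm
  have hmg : ∀ x, m ≤ g x := fun x => csInf_le hbdd ⟨x, rfl⟩
  refine le_trans ?_ (hmg x)
  by_contra! hm0
  -- Suppose the infimum `m` is negative. Beyond `K`, `g` is at least `m / 2`. Below `K`, the chain
  -- reaches the negative half-line, where `g ≥ 0`, with probability at least `δ`, so `g ≥ m * (1 -
  -- δ)`. Both bounds exceed `m`.
  obtain ⟨K, hK⟩ := hinf (-m / 2) (by linarith)
  obtain ⟨δ, hδ, hδK⟩ := exists_le_chain_neg (b := b) hlam hlam' hmu hmu' hd (le_max_right K 0)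
  have hlow : ∀ x, min (m / 2) (m * (1 - δ)) ≤ g x := by
    intro x
    rcases lt_or_ge x 0 with hx | hx
    · exact (min_le_left _ _).trans (by linarith [hneg x hx])
    rcases le_or_gt K x with hxK | hxK
    · exact (min_le_left _ _).trans (by linarith [hK x hxK])
    refine (min_le_right _ _).trans (le_trans ?_ (hsuper x hx))
    have := isProbabilityMeasure_chain (b := b) (d := d) hlam hlam' hmu hmu' x
    have h1 : ∫ z, (Set.Ici (0 : ℝ)).indicator (fun _ => m) z ∂(chain lam lam' mu mu' b d x)
        ≤ ∫ z, g z ∂(chain lam lam' mu mu' b d x) := by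
      refine integral_mono ((integrable_const m).indicator measurableSet_Ici)
        (Integrable.of_bound hg.aestronglyMeasurable M (Filter.Eventually.of_forall hM))
        fun z => ?_
      by_cases hz : 0 ≤ z
      · rw [Set.indicator_of_mem (Set.mem_Ici.2 hz)]; exact hmg z
      · rw [Set.indicator_of_notMem (by simpa using hz)]; exact hneg z (not_le.1 hz)
    refine le_trans ?_ h1
    rw [integral_indicator measurableSet_Ici, setIntegral_const, smul_eq_mul, ← Set.compl_Iio,
      probReal_compl_eq_one_sub measurableSet_Iio]
    have h2 := hδK x (hxK.le.trans (le_max_left _ _))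
    nlinarith
  have h3 : min (m / 2) (m * (1 - δ)) ≤ m :=
    le_csInf (Set.range_nonempty g) (by rintro _ ⟨x, rfl⟩; exact hlow x)
  rcases min_le_iff.1 h3 with h | h
  · linarith
  · nlinarith

/-- A bounded harmonic function which is `1` after ruin and vanishes at infinity is the
probability of ruin. -/
theorem ruin_eq_of_harmonic (hlam : 0 < lam) (hlam' : 0 < lam') (hmu : 0 < mu) (hmu' : 0 < mu')
    (hd : 0 < d) {φ : ℝ → ℝ} (hφ : Measurable φ) {M : ℝ} (hM : ∀ x, |φ x| ≤ M)
    (hone : ∀ x < 0, φ x = 1)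
    (hharm : ∀ x, 0 ≤ x → ∫ z, φ z ∂(chain lam lam' mu mu' b d x) = φ x)
    (hlim : Filter.Tendsto φ Filter.atTop (nhds 0)) {x : ℝ} :
    (dataLaw lam lam' mu mu').real (Prod.mk x ⁻¹' ruinEvent b d) = φ x := by
  have := isProbabilityMeasure_dataLaw hlam hlam' hmu hmu'
  have hint : ∀ x, Integrable φ (chain lam lam' mu mu' b d x) := fun x =>
    have := isProbabilityMeasure_chain (b := b) (d := d) hlam hlam' hmu hmu' x
    Integrable.of_bound hφ.aestronglyMeasurable M (Filter.Eventually.of_forall hM)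
  have hev : ∀ ε > 0, ∃ K, ∀ x ≥ K, |φ x| < ε := fun ε hε =>
    Filter.eventually_atTop.1 ((Metric.tendsto_nhds.1 hlim ε hε).mono fun x hx => by
      simpa [Real.dist_eq] using hx)
  have hφ0 : ∀ x, 0 ≤ φ x := nonneg_of_superharmonic (b := b) hlam hlam' hmu hmu' hd hφ hM
    (fun x hx => by rw [hone x hx]; exact zero_le_one) (fun x hx => (hharm x hx).le)
    fun ε hε => (hev ε hε).imp fun K hK x hx => (abs_lt.1 (hK x hx)).1.le
  have hψm : Measurable fun z => dataLaw lam lam' mu mu' (Prod.mk z ⁻¹' ruinEvent b d) :=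
    measurable_measure_prodMk_left measurableSet_ruinEvent
  have hneg : ∀ x < 0, dataLaw lam lam' mu mu' (Prod.mk x ⁻¹' ruinEvent b d) = 1 := by
    intro x hx
    have : Prod.mk x ⁻¹' ruinEvent b d = Set.univ :=
      Set.eq_univ_of_forall fun s => Set.mem_iUnion.2 ⟨0, hx⟩
    rw [this, measure_univ]
  -- Averaging over one jump preserves the inequality, and harmonicity returns `φ` on the right.
  have hle : ∀ n x, dataLaw lam lam' mu mu' (Prod.mk x ⁻¹' ruinSet b d n)
      ≤ ENNReal.ofReal (φ x) := by
    intro n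
    induction n with
    | zero =>
      intro x
      rcases lt_or_ge x 0 with hx | hx
      · rw [hone x hx, ENNReal.ofReal_one]; exact prob_le_one
      · have : Prod.mk x ⁻¹' ruinSet b d 0 = ∅ :=
          Set.eq_empty_of_forall_notMem fun s hs => absurd hx (not_le.2 hs)
        rw [this, measure_empty]; exact zero_le
    | succ n ih =>
      intro x
      rcases lt_or_ge x 0 with hx | hx
      · rw [hone x hx, ENNReal.ofReal_one]; exact prob_le_one
      · have : Prod.mk x ⁻¹' ruinSet b d (n + 1) = {s | step b d (x, s) ∈ ruinSet b d n} := by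
          ext s
          exact or_iff_right (not_lt.2 hx)
        rw [this, dataLaw_step hlam hlam' hmu hmu' (measurableSet_ruinSet n), ← hharm x hx,
          ofReal_integral_eq_lintegral_ofReal (hint x) (Filter.Eventually.of_forall hφ0)]
        exact lintegral_mono ih
  have hmono : Monotone fun n => Prod.mk x ⁻¹' ruinSet b d n := by
    suffices h : Monotone (ruinSet b d) from fun m n hmn s hs => h hmn hs
    refine monotone_nat_of_le_succ fun n => ?_
    induction n with
    | zero => exact Set.subset_union_left
    | succ n ih => exact Set.union_subset_union_right _ (Set.preimage_mono ih)
  have hupper : (dataLaw lam lam' mu mu').real (Prod.mk x ⁻¹' ruinEvent b d) ≤ φ x := by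
    refine ENNReal.toReal_le_of_le_ofReal (hφ0 x) ?_
    rw [ruinEvent, Set.preimage_iUnion, hmono.measure_iUnion]
    exact iSup_le fun n => hle n x
  refine le_antisymm hupper (sub_nonneg.1 ?_)
  have hψr : Measurable fun x => (dataLaw lam lam' mu mu').real (Prod.mk x ⁻¹' ruinEvent b d) :=
    hψm.ennreal_toReal
  -- The difference vanishes after ruin, is harmonic, and is at least `-φ`, which tends to `0`; the
  -- behaviour of the ruin probability at infinity need not be known.
  refine nonneg_of_superharmonic (b := b) (M := 1 + M)
    (g := fun x => (dataLaw lam lam' mu mu').real (Prod.mk x ⁻¹' ruinEvent b d) - φ x)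
    hlam hlam' hmu hmu' hd (hψr.sub hφ) (fun x => ?_) (fun x hx => ?_) (fun x hx => le_of_eq ?_)
    (fun ε hε => ?_) x
  · refine (abs_sub _ _).trans (add_le_add ?_ (hM x))
    rw [abs_of_nonneg measureReal_nonneg]
    exact measureReal_le_one
  · rw [measureReal_def, hneg x hx, hone x hx]; simp
  · have := isProbabilityMeasure_chain (b := b) (d := d) hlam hlam' hmu hmu' x
    rw [integral_sub (Integrable.of_bound hψr.aestronglyMeasurable 1
      (Filter.Eventually.of_forall fun x => by
        rw [Real.norm_of_nonneg measureReal_nonneg]; exact measureReal_le_one)) (hint x), hharm x hx]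
    congr 1
    simp only [measureReal_def]
    rw [integral_toReal hψm.aemeasurable
      (Filter.Eventually.of_forall fun z => measure_lt_top _ _),
      ← dataLaw_step hlam hlam' hmu hmu' measurableSet_ruinEvent]
    congr 2
    ext s
    simp only [ruinEvent, Set.mem_preimage, Set.mem_iUnion, Set.mem_ofPred_eq]
    constructor
    · rintro ⟨n, hn⟩
      exact ⟨n + 1, Or.inr hn⟩
    · rintro ⟨n, hn⟩
      cases n with
      | zero => exact absurd hx (not_le.2 hn)
      | succ n => exact ⟨n, hn.resolve_left (not_lt.2 hx)⟩
  · refine (hev ε hε).imp fun K hK x hx => ?_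
    have := (abs_lt.1 (hK x hx)).2
    have h0 : 0 ≤ (dataLaw lam lam' mu mu').real (Prod.mk x ⁻¹' ruinEvent b d) :=
      measureReal_nonneg
    linarith

end Chain

/-! ### Integrals of exponentials -/

section Integrals

variable {r σ A B α β a c x : ℝ}

/-- A combination of two exponential functions. -/
noncomputable def twoExp (A α B β x : ℝ) : ℝ := A * Real.exp (α * x) + B * Real.exp (β * x)

@[fun_prop]
lemma continuous_twoExp : Continuous (twoExp A α B β) := by
  unfold twoExp; fun_prop

/-- The factors `r + σ * α` are kept in the integrand to avoid division in the primitive. The speed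
`σ` is `1` for claims, `-1` for premiums, `d` for the dividend drift and `0` for a surplus resting
at `b`. -/
lemma hasDerivAt_exp_mul_twoExp (r σ A α B β x t : ℝ) :
    HasDerivAt (fun t => -(Real.exp (-(r * t)) * twoExp A α B β (x - σ * t)))
      (Real.exp (-(r * t)) * twoExp (A * (r + σ * α)) α (B * (r + σ * β)) β (x - σ * t)) t := by
  have h1 : HasDerivAt (fun t => Real.exp (-(r * t))) (Real.exp (-(r * t)) * -(r * 1)) t :=
    ((hasDerivAt_id t).const_mul r).neg.exp
  have h2 : ∀ γ, HasDerivAt (fun t => Real.exp (γ * (x - σ * t)))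
      (Real.exp (γ * (x - σ * t)) * (γ * (-(σ * 1)))) t := fun γ =>
    ((((hasDerivAt_id t).const_mul σ).const_sub x).const_mul γ).exp
  refine (h1.mul (((h2 α).const_mul A).add ((h2 β).const_mul B))).neg.congr_deriv ?_
  simp only [twoExp, Pi.add_apply]
  ring

lemma integral_exp_mul_twoExp (r σ A α B β x a c : ℝ) :
    ∫ t in a..c, Real.exp (-(r * t))
        * twoExp (A * (r + σ * α)) α (B * (r + σ * β)) β (x - σ * t)
      = Real.exp (-(r * a)) * twoExp A α B β (x - σ * a)
        - Real.exp (-(r * c)) * twoExp A α B β (x - σ * c) := by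
  rw [intervalIntegral.integral_eq_sub_of_hasDerivAt
    (fun t _ => hasDerivAt_exp_mul_twoExp r σ A α B β x t)
    (Continuous.intervalIntegrable (by fun_prop) _ _)]
  ring

lemma integral_Ioi_exp_mul_twoExp (hα : 0 < r + σ * α) (hβ : 0 < r + σ * β) :
    ∫ t in Set.Ioi a, Real.exp (-(r * t))
        * twoExp (A * (r + σ * α)) α (B * (r + σ * β)) β (x - σ * t)
      = Real.exp (-(r * a)) * twoExp A α B β (x - σ * a) := by
  have hexp : ∀ γ t, Real.exp (-(r * t)) * Real.exp (γ * (x - σ * t))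
      = Real.exp (γ * x) * Real.exp (-(r + σ * γ) * t) := fun γ t => by
    rw [← Real.exp_add, ← Real.exp_add]; congr 1; ring
  have hform : ∀ A B t, Real.exp (-(r * t)) * twoExp A α B β (x - σ * t)
      = A * Real.exp (α * x) * Real.exp (-(r + σ * α) * t)
        + B * Real.exp (β * x) * Real.exp (-(r + σ * β) * t) := fun A B t => by
    rw [twoExp]; linear_combination A * hexp α t + B * hexp β t
  have hlim : ∀ γ, 0 < γ → Filter.Tendsto (fun t => Real.exp (-γ * t)) Filter.atTop (nhds 0) :=
    fun γ hγ => Real.tendsto_exp_atBot.comp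
      (Filter.tendsto_id.const_mul_atTop_of_neg (neg_lt_zero.2 hγ))
  rw [integral_Ioi_of_hasDerivAt_of_tendsto' (m := 0)
    (fun t _ => hasDerivAt_exp_mul_twoExp r σ A α B β x t)]
  · ring
  · simp_rw [hform]
    exact ((exp_neg_integrableOn_Ioi a hα).const_mul _).add
      ((exp_neg_integrableOn_Ioi a hβ).const_mul _)
  · simp_rw [hform]
    have := ((hlim _ hα).const_mul (A * Real.exp (α * x))).add
      ((hlim _ hβ).const_mul (B * Real.exp (β * x)))
    simpa using this.neg

lemma expMeasure_eq (r : ℝ) : expMeasure r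
    = (volume.restrict (Set.Ioi 0)).withDensity
        fun t => ENNReal.ofReal (r * Real.exp (-(r * t))) := by
  refine Measure.ext_of_lintegral _ fun f hf => ?_
  rw [lintegral_expMeasure r hf, restrict_Ioi_eq_restrict_Ici,
    lintegral_withDensity_eq_lintegral_mul _ (by fun_prop) hf]
  rfl

lemma integrableOn_of_integrable_expMeasure (hr : 0 ≤ r) {f : ℝ → ℝ}
    (hf : Integrable f (expMeasure r)) :
    IntegrableOn (fun t => Real.exp (-(r * t)) * (r * f t)) (Set.Ioi 0) := by
  rw [expMeasure_eq, integrable_withDensity_iff_integrable_smul' (by fun_prop) (by simp)] at hf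
  refine hf.congr (Filter.Eventually.of_forall fun t => ?_)
  simp only [smul_eq_mul]
  rw [ENNReal.toReal_ofReal (by positivity)]
  ring

lemma integral_expMeasure (hr : 0 ≤ r) (f : ℝ → ℝ) :
    ∫ t, f t ∂(expMeasure r) = ∫ t in Set.Ioi 0, Real.exp (-(r * t)) * (r * f t) := by
  rw [expMeasure_eq, integral_withDensity_eq_integral_toReal_smul (by fun_prop) (by simp)]
  refine integral_congr_ae (Filter.Eventually.of_forall fun t => ?_)
  simp only [smul_eq_mul]
  rw [ENNReal.toReal_ofReal (by positivity)]
  ring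

lemma integral_expMeasure_split (hr : 0 ≤ r) {f : ℝ → ℝ} (hf : Integrable f (expMeasure r))
    (hc : 0 ≤ c) :
    ∫ t, f t ∂(expMeasure r) = (∫ t in (0 : ℝ)..c, Real.exp (-(r * t)) * (r * f t))
      + ∫ t in Set.Ioi c, Real.exp (-(r * t)) * (r * f t) := by
  have h := integrableOn_of_integrable_expMeasure hr hf
  rw [integral_expMeasure hr, intervalIntegral.integral_of_le hc,
    ← setIntegral_union (Set.Ioc_disjoint_Ioi le_rfl) measurableSet_Ioi
      (h.mono_set Set.Ioc_subset_Ioi_self) (h.mono_set (Set.Ioi_subset_Ioi hc)),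
    Set.Ioc_union_Ioi_eq_Ioi hc]

lemma integral_congr_Ioc {f g : ℝ → ℝ} (hac : a ≤ c) (h : ∀ t ∈ Set.Ioc a c, f t = g t) :
    ∫ t in a..c, f t = ∫ t in a..c, g t := by
  rw [intervalIntegral.integral_of_le hac, intervalIntegral.integral_of_le hac,
    setIntegral_congr_fun measurableSet_Ioc h]

end Integrals

/-! ### The candidate and its averages over a jump -/

section Candidate

variable {lam lam' mu mu' b d u v w C4 C5 C7 C8 x : ℝ}

/-- The candidate for the ruin probability, extended by `1` to negative surpluses. -/
noncomputable def candidate (b u v w C4 C5 C7 C8 x : ℝ) : ℝ :=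
  if x < 0 then 1 else if x ≤ b then twoExp C4 0 C5 u x else twoExp C7 v C8 w x

lemma candidate_of_neg (hx : x < 0) : candidate b u v w C4 C5 C7 C8 x = 1 := if_pos hx

lemma candidate_of_le (hx : 0 ≤ x) (hxb : x ≤ b) :
    candidate b u v w C4 C5 C7 C8 x = twoExp C4 0 C5 u x := by
  rw [candidate, if_neg (not_lt.2 hx), if_pos hxb]

lemma candidate_of_ge (hb : 0 ≤ b) (hcont : twoExp C4 0 C5 u b = twoExp C7 v C8 w b)
    (hx : b ≤ x) : candidate b u v w C4 C5 C7 C8 x = twoExp C7 v C8 w x := by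
  rw [candidate, if_neg (not_lt.2 (hb.trans hx))]
  split_ifs with h
  · rw [le_antisymm h hx, hcont]
  · rfl

@[fun_prop]
lemma measurable_candidate : Measurable (candidate b u v w C4 C5 C7 C8) :=
  Measurable.ite measurableSet_Iio measurable_const
    (Measurable.ite measurableSet_Iic continuous_twoExp.measurable continuous_twoExp.measurable)

lemma abs_twoExp_le {A α B β : ℝ} (hα : α ≤ 0) (hβ : β ≤ 0) (hx : 0 ≤ x) :
    |twoExp A α B β x| ≤ |A| + |B| := by
  have h : ∀ γ D : ℝ, γ ≤ 0 → |D * Real.exp (γ * x)| ≤ |D| := fun γ D hγ => by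
    rw [abs_mul, abs_of_pos (Real.exp_pos _)]
    exact mul_le_of_le_one_right (abs_nonneg _)
      (Real.exp_le_one_iff.2 (mul_nonpos_of_nonpos_of_nonneg hγ hx))
  exact (abs_add_le _ _).trans (add_le_add (h α A hα) (h β B hβ))

lemma abs_candidate_le (hu : u ≤ 0) (hv : v ≤ 0) (hw : w ≤ 0) (x : ℝ) :
    |candidate b u v w C4 C5 C7 C8 x| ≤ 1 + (|C4| + |C5|) + (|C7| + |C8|) := by
  have := abs_nonneg C4
  have := abs_nonneg C5
  have := abs_nonneg C7
  have := abs_nonneg C8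
  unfold candidate
  split_ifs with h1 h2
  · rw [abs_one]; linarith
  · linarith [abs_twoExp_le (A := C4) (B := C5) le_rfl hu (not_lt.1 h1)]
  · linarith [abs_twoExp_le (A := C7) (B := C8) hv hw (not_lt.1 h1)]

lemma integrable_candidate {E : Type*} [MeasurableSpace E] {μ : Measure E} [IsFiniteMeasure μ]
    (hu : u ≤ 0) (hv : v ≤ 0) (hw : w ≤ 0) {f : E → ℝ} (hf : Measurable f) :
    Integrable (fun y => candidate b u v w C4 C5 C7 C8 (f y)) μ :=
  Integrable.of_bound (measurable_candidate.comp hf).aestronglyMeasurable _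
    (Filter.Eventually.of_forall fun _ => abs_candidate_le hu hv hw _)

lemma tendsto_candidate (hb : 0 ≤ b) (hv : v < 0) (hw : w < 0) :
    Filter.Tendsto (candidate b u v w C4 C5 C7 C8) Filter.atTop (nhds 0) := by
  have hlim : ∀ γ < 0, Filter.Tendsto (fun t => Real.exp (γ * t)) Filter.atTop (nhds 0) :=
    fun γ hγ => Real.tendsto_exp_atBot.comp (Filter.tendsto_id.const_mul_atTop_of_neg hγ)
  have h := ((hlim v hv).const_mul C7).add ((hlim w hw).const_mul C8)
  simp only [mul_zero, add_zero] at h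
  refine h.congr' ((Filter.eventually_gt_atTop b).mono fun x hx => ?_)
  rw [candidate, if_neg (not_lt.2 (hb.trans hx.le)), if_neg (not_le.2 hx), twoExp]

/-- Brings the density factor `m⁻¹` into the form whose primitive is known; the divisors `1 + m * (σ
* α)` are those of the characteristic equations. -/
lemma exp_mul_twoExp_eq {m σ A α B β y z : ℝ} (hm : 0 < m) (hα : 1 + m * (σ * α) ≠ 0)
    (hβ : 1 + m * (σ * β) ≠ 0) :
    y * (m⁻¹ * twoExp A α B β z)
      = y * twoExp (A / (1 + m * (σ * α)) * (m⁻¹ + σ * α)) α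
          (B / (1 + m * (σ * β)) * (m⁻¹ + σ * β)) β z := by
  have h : ∀ D γ : ℝ, 1 + m * (σ * γ) ≠ 0 →
      D / (1 + m * (σ * γ)) * (m⁻¹ + σ * γ) = m⁻¹ * D := fun D γ hγ => by
    have : m⁻¹ + σ * γ = m⁻¹ * (1 + m * (σ * γ)) := by
      rw [mul_add, mul_one, inv_mul_cancel_left₀ hm.ne']
    rw [this, mul_left_comm, div_mul_cancel₀ _ hγ]
  rw [h _ _ hα, h _ _ hβ]
  unfold twoExp; ring

/-- The expected value after a claim, from a surplus below the threshold. -/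
lemma integral_candidate_claim_low (hmu : 0 < mu) (hu : u ≤ 0) (hv : v ≤ 0) (hw : w ≤ 0)
    (hu' : 1 + mu * u ≠ 0) (hx : 0 ≤ x) (hxb : x ≤ b) :
    ∫ y, candidate b u v w C4 C5 C7 C8 (x - y) ∂(expMeasure mu⁻¹)
      = twoExp C4 0 (C5 / (1 + mu * u)) u x
        + Real.exp (-(mu⁻¹ * x)) * (1 - C4 - C5 / (1 + mu * u)) := by
  have := isProbabilityMeasure_expMeasure (inv_pos.2 hmu)
  -- Claims larger than `x` cause ruin; the value `1` there is written as a `twoExp` with zero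
  -- exponents.
  rw [integral_expMeasure_split (inv_pos.2 hmu).le
    (integrable_candidate hu hv hw (by fun_prop)) hx,
    integral_congr_Ioc (g := fun y => Real.exp (-(mu⁻¹ * y))
      * twoExp (C4 / (1 + mu * (1 * 0)) * (mu⁻¹ + 1 * 0)) 0
          (C5 / (1 + mu * (1 * u)) * (mu⁻¹ + 1 * u)) u (x - 1 * y)) hx,
    integral_exp_mul_twoExp,
    setIntegral_congr_fun (g := fun y => Real.exp (-(mu⁻¹ * y))
      * twoExp (1 * (mu⁻¹ + 1 * 0)) 0 (0 * (mu⁻¹ + 1 * 0)) 0 (x - 1 * y)) measurableSet_Ioi,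
    integral_Ioi_exp_mul_twoExp (by simpa using hmu) (by simpa using hmu)]
  · simp only [twoExp, one_mul, mul_zero, zero_mul, sub_zero, sub_self, neg_zero, Real.exp_zero,
      add_zero, mul_one, div_one]
    ring
  · intro y hy
    simp only
    rw [candidate_of_neg (by linarith [Set.mem_Ioi.1 hy])]
    simp [twoExp]
  · intro y hy
    rw [candidate_of_le (by linarith [hy.2]) (by linarith [hy.1]),
      exp_mul_twoExp_eq (σ := 1) hmu (by simp) (by simpa using hu'), one_mul y]

/-- The expected value after a claim, from a surplus above the threshold. -/
lemma integral_candidate_claim_high (hmu : 0 < mu) (hb : 0 ≤ b) (hu : u ≤ 0) (hv : v ≤ 0)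
    (hw : w ≤ 0) (hu' : 1 + mu * u ≠ 0) (hv' : 1 + mu * v ≠ 0) (hw' : 1 + mu * w ≠ 0)
    (hcont : twoExp C4 0 C5 u b = twoExp C7 v C8 w b) (hxb : b ≤ x) :
    ∫ y, candidate b u v w C4 C5 C7 C8 (x - y) ∂(expMeasure mu⁻¹)
      = twoExp (C7 / (1 + mu * v)) v (C8 / (1 + mu * w)) w x
        + Real.exp (-(mu⁻¹ * (x - b))) * (Real.exp (-(mu⁻¹ * b))
          + C4 * (1 - Real.exp (-(mu⁻¹ * b)))
          + C5 / (1 + mu * u) * (Real.exp (u * b) - Real.exp (-(mu⁻¹ * b)))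
          - twoExp (C7 / (1 + mu * v)) v (C8 / (1 + mu * w)) w b) := by
  have := isProbabilityMeasure_expMeasure (inv_pos.2 hmu)
  have hint : Integrable (fun y => candidate b u v w C4 C5 C7 C8 (x - y)) (expMeasure mu⁻¹) :=
    integrable_candidate hu hv hw (by fun_prop)
  have hintOn := integrableOn_of_integrable_expMeasure (inv_pos.2 hmu).le hint
  have hii : ∀ p q, 0 ≤ p → p ≤ q → IntervalIntegrable (fun y => Real.exp (-(mu⁻¹ * y))
      * (mu⁻¹ * candidate b u v w C4 C5 C7 C8 (x - y))) volume p q := fun p q hp hpq =>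
    (intervalIntegrable_iff_integrableOn_Ioc_of_le hpq).2
      (hintOn.mono_set fun y hy => hp.trans_lt hy.1)
  -- Three ranges of claims: the surplus stays above `b`, lands in `[0, b]`, or becomes negative.
  -- The boundary terms share the factor `exp (-(mu⁻¹ * (x - b)))`.
  rw [integral_expMeasure_split (inv_pos.2 hmu).le hint (hb.trans hxb),
    ← intervalIntegral.integral_add_adjacent_intervals
      (hii 0 (x - b) le_rfl (by linarith)) (hii (x - b) x (by linarith) (by linarith)),
    integral_congr_Ioc (g := fun y => Real.exp (-(mu⁻¹ * y))
      * twoExp (C7 / (1 + mu * (1 * v)) * (mu⁻¹ + 1 * v)) v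
          (C8 / (1 + mu * (1 * w)) * (mu⁻¹ + 1 * w)) w (x - 1 * y)) (by linarith),
    integral_exp_mul_twoExp,
    integral_congr_Ioc (g := fun y => Real.exp (-(mu⁻¹ * y))
      * twoExp (C4 / (1 + mu * (1 * 0)) * (mu⁻¹ + 1 * 0)) 0
          (C5 / (1 + mu * (1 * u)) * (mu⁻¹ + 1 * u)) u (x - 1 * y)) (by linarith),
    integral_exp_mul_twoExp,
    setIntegral_congr_fun (g := fun y => Real.exp (-(mu⁻¹ * y))
      * twoExp (1 * (mu⁻¹ + 1 * 0)) 0 (0 * (mu⁻¹ + 1 * 0)) 0 (x - 1 * y)) measurableSet_Ioi,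
    integral_Ioi_exp_mul_twoExp (by simpa using hmu) (by simpa using hmu)]
  · have hexp : Real.exp (-(mu⁻¹ * x)) = Real.exp (-(mu⁻¹ * (x - b))) * Real.exp (-(mu⁻¹ * b)) := by
      rw [← Real.exp_add]; congr 1; ring
    simp only [twoExp, one_mul, mul_zero, zero_mul, sub_zero, sub_self, neg_zero, Real.exp_zero,
      add_zero, mul_one, div_one, sub_sub_cancel, hexp]
    ring
  · intro y hy
    simp only
    rw [candidate_of_neg (by linarith [Set.mem_Ioi.1 hy])]
    simp [twoExp]
  · intro y hy
    rw [candidate_of_le (by linarith [hy.2]) (by linarith [hy.1]),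
      exp_mul_twoExp_eq (σ := 1) hmu (by simp) (by simpa using hu'), one_mul y]
  · intro y hy
    rw [candidate_of_ge hb hcont (by linarith [hy.2]),
      exp_mul_twoExp_eq (σ := 1) hmu (by simpa using hv') (by simpa using hw'), one_mul y]

/-- The expected value after a premium, from a surplus above the threshold. -/
lemma integral_candidate_premium_high (hmu' : 0 < mu') (hb : 0 ≤ b) (hv : v ≤ 0) (hw : w ≤ 0)
    (hcont : twoExp C4 0 C5 u b = twoExp C7 v C8 w b) (hxb : b ≤ x) :
    ∫ y, candidate b u v w C4 C5 C7 C8 (x + y) ∂(expMeasure mu'⁻¹)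
      = twoExp (C7 / (1 - mu' * v)) v (C8 / (1 - mu' * w)) w x := by
  have h : ∀ z ≤ 0, 0 < 1 + mu' * (-1 * z) := fun z hz => by
    nlinarith [mul_nonneg hmu'.le (neg_nonneg.2 hz)]
  have hinv := inv_pos.2 hmu'
  rw [integral_expMeasure hinv.le,
    setIntegral_congr_fun (g := fun y => Real.exp (-(mu'⁻¹ * y))
      * twoExp (C7 / (1 + mu' * (-1 * v)) * (mu'⁻¹ + -1 * v)) v
          (C8 / (1 + mu' * (-1 * w)) * (mu'⁻¹ + -1 * w)) w (x - -1 * y)) measurableSet_Ioi,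
    integral_Ioi_exp_mul_twoExp (by linarith) (by linarith)]
  · simp [sub_eq_add_neg]
  · intro y hy
    simp only
    rw [candidate_of_ge hb hcont (by linarith [Set.mem_Ioi.1 hy]),
      exp_mul_twoExp_eq (σ := -1) hmu' (h v hv).ne' (h w hw).ne', neg_one_mul y, sub_neg_eq_add]

/-- The expected value after a premium, from a surplus below the threshold. -/
lemma integral_candidate_premium_low (hmu' : 0 < mu') (hb : 0 ≤ b) (hu : u ≤ 0) (hv : v ≤ 0)
    (hw : w ≤ 0) (hcont : twoExp C4 0 C5 u b = twoExp C7 v C8 w b) (hx : 0 ≤ x) (hxb : x ≤ b) :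
    ∫ y, candidate b u v w C4 C5 C7 C8 (x + y) ∂(expMeasure mu'⁻¹)
      = twoExp C4 0 (C5 / (1 - mu' * u)) u x
        + Real.exp (-(mu'⁻¹ * (b - x)))
          * (twoExp (C7 / (1 - mu' * v)) v (C8 / (1 - mu' * w)) w b
            - twoExp C4 0 (C5 / (1 - mu' * u)) u b) := by
  have h : ∀ z ≤ 0, 0 < 1 + mu' * (-1 * z) := fun z hz => by
    nlinarith [mul_nonneg hmu'.le (neg_nonneg.2 hz)]
  have hinv := inv_pos.2 hmu'
  have := isProbabilityMeasure_expMeasure hinv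
  -- The premium carries the surplus across the threshold at size `b - x`.
  rw [integral_expMeasure_split hinv.le
    (integrable_candidate hu hv hw (by fun_prop)) (sub_nonneg.2 hxb),
    integral_congr_Ioc (g := fun y => Real.exp (-(mu'⁻¹ * y))
      * twoExp (C4 / (1 + mu' * (-1 * 0)) * (mu'⁻¹ + -1 * 0)) 0
          (C5 / (1 + mu' * (-1 * u)) * (mu'⁻¹ + -1 * u)) u (x - -1 * y)) (sub_nonneg.2 hxb),
    integral_exp_mul_twoExp,
    setIntegral_congr_fun (g := fun y => Real.exp (-(mu'⁻¹ * y))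
      * twoExp (C7 / (1 + mu' * (-1 * v)) * (mu'⁻¹ + -1 * v)) v
          (C8 / (1 + mu' * (-1 * w)) * (mu'⁻¹ + -1 * w)) w (x - -1 * y)) measurableSet_Ioi,
    integral_Ioi_exp_mul_twoExp (by linarith) (by linarith)]
  · have hxb' : x - -1 * (b - x) = b := by ring
    rw [hxb']
    simp only [neg_one_mul, mul_neg, ← sub_eq_add_neg, neg_zero, mul_zero, sub_zero, add_zero,
      div_one, Real.exp_zero, one_mul]
    ring
  · intro y hy
    simp only
    rw [candidate_of_ge hb hcont (by linarith [Set.mem_Ioi.1 hy]),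
      exp_mul_twoExp_eq (σ := -1) hmu' (h v hv).ne' (h w hw).ne', neg_one_mul y, sub_neg_eq_add]
  · intro y hy
    rw [candidate_of_le (by linarith [hy.1]) (by linarith [hy.2]),
      exp_mul_twoExp_eq (σ := -1) hmu' (by simp) (h u hu).ne', neg_one_mul y, sub_neg_eq_add]

end Candidate

/-! ### Harmonicity of the candidate -/

section Harmonic

variable {lam lam' mu mu' b d u v w C4 C5 C7 C8 x : ℝ}

lemma integral_jumpLaw (hlam : 0 < lam) (hlam' : 0 < lam') (hmu : 0 < mu) (hmu' : 0 < mu')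
    (hu : u ≤ 0) (hv : v ≤ 0) (hw : w ≤ 0) :
    ∫ j, candidate b u v w C4 C5 C7 C8 (x + j) ∂(jumpLaw lam lam' mu mu')
      = (lam * ∫ y, candidate b u v w C4 C5 C7 C8 (x - y) ∂(expMeasure mu⁻¹)
        + lam' * ∫ y, candidate b u v w C4 C5 C7 C8 (x + y) ∂(expMeasure mu'⁻¹))
          / (lam + lam') := by
  have := isProbabilityMeasure_expMeasure (inv_pos.2 hmu)
  have := isProbabilityMeasure_expMeasure (inv_pos.2 hmu')
  have : IsProbabilityMeasure ((expMeasure mu⁻¹).map (fun y => -y)) :=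
    Measure.isProbabilityMeasure_map (by fun_prop)
  have hm : Measurable fun j => candidate b u v w C4 C5 C7 C8 (x + j) := by fun_prop
  rw [jumpLaw, integral_add_measure
    ((integrable_candidate hu hv hw (by fun_prop)).smul_measure ENNReal.ofReal_ne_top)
    ((integrable_candidate hu hv hw (by fun_prop)).smul_measure ENNReal.ofReal_ne_top),
    integral_smul_measure, integral_smul_measure, integral_map (by fun_prop)
      hm.aestronglyMeasurable, ENNReal.toReal_ofReal (by positivity),
    ENNReal.toReal_ofReal (by positivity), smul_eq_mul, smul_eq_mul]
  simp only [← sub_eq_add_neg]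
  ring

/-- The candidate solves the integral equation on `[0, b]`. -/
lemma integral_jumpLaw_low (hlam : 0 < lam) (hlam' : 0 < lam') (hmu : 0 < mu) (hmu' : 0 < mu')
    (hb : 0 ≤ b) (hu : u ≤ 0) (hv : v ≤ 0) (hw : w ≤ 0) (hu' : 1 + mu * u ≠ 0)
    (hchar : lam + lam' = lam / (1 + mu * u) + lam' / (1 - mu' * u))
    (hcont : twoExp C4 0 C5 u b = twoExp C7 v C8 w b)
    (hclaim : C4 + C5 / (1 + mu * u) = 1)
    (hpremium : twoExp C4 0 (C5 / (1 - mu' * u)) u b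
      = twoExp (C7 / (1 - mu' * v)) v (C8 / (1 - mu' * w)) w b)
    (hx : 0 ≤ x) (hxb : x ≤ b) :
    ∫ j, candidate b u v w C4 C5 C7 C8 (x + j) ∂(jumpLaw lam lam' mu mu')
      = twoExp C4 0 C5 u x := by
  rw [integral_jumpLaw hlam hlam' hmu hmu' hu hv hw, div_eq_iff (by positivity),
    integral_candidate_claim_low hmu hu hv hw hu' hx hxb,
    integral_candidate_premium_low hmu' hb hu hv hw hcont hx hxb, hpremium]
  simp only [twoExp]
  linear_combination (-C5 * Real.exp (u * x)) * hchar
    - lam * Real.exp (-(mu⁻¹ * x)) * hclaim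

/-- The candidate solves the integro-differential equation above `b`. -/
lemma integral_jumpLaw_high (hlam : 0 < lam) (hlam' : 0 < lam') (hmu : 0 < mu) (hmu' : 0 < mu')
    (hb : 0 ≤ b) (hu : u ≤ 0) (hv : v ≤ 0) (hw : w ≤ 0) (hu' : 1 + mu * u ≠ 0)
    (hv' : 1 + mu * v ≠ 0) (hw' : 1 + mu * w ≠ 0)
    (hcharv : lam + lam' + d * v = lam / (1 + mu * v) + lam' / (1 - mu' * v))
    (hcharw : lam + lam' + d * w = lam / (1 + mu * w) + lam' / (1 - mu' * w))
    (hcont : twoExp C4 0 C5 u b = twoExp C7 v C8 w b)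
    (hhigh : Real.exp (-(mu⁻¹ * b)) + C4 * (1 - Real.exp (-(mu⁻¹ * b)))
          + C5 / (1 + mu * u) * (Real.exp (u * b) - Real.exp (-(mu⁻¹ * b)))
          = twoExp (C7 / (1 + mu * v)) v (C8 / (1 + mu * w)) w b)
    (hxb : b ≤ x) :
    (lam + lam') * ∫ j, candidate b u v w C4 C5 C7 C8 (x + j) ∂(jumpLaw lam lam' mu mu')
      = twoExp (C7 * (lam + lam' + d * v)) v (C8 * (lam + lam' + d * w)) w x := by
  rw [integral_jumpLaw hlam hlam' hmu hmu' hu hv hw, mul_div_cancel₀ _ (by positivity),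
    integral_candidate_claim_high hmu hb hu hv hw hu' hv' hw' hcont hxb,
    integral_candidate_premium_high hmu' hb hv hw hcont hxb, hhigh, sub_self, mul_zero, add_zero]
  simp only [twoExp]
  linear_combination (-C7 * Real.exp (v * x)) * hcharv - (C8 * Real.exp (w * x)) * hcharw

/-- From `x ≤ b` the surplus waits at `x`, so averaging over the jump suffices. From `x ≥ b`, the
part before time `(x - b) / d` integrates a derivative and gives the value at `x` minus a discounted
value at `b`. The rest, spent at `b`, restores exactly that term by continuity. -/
theorem candidate_harmonic (hlam : 0 < lam) (hlam' : 0 < lam') (hmu : 0 < mu) (hmu' : 0 < mu')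
    (hb : 0 ≤ b) (hd : 0 < d) (hu : u ≤ 0) (hv : v ≤ 0) (hw : w ≤ 0) (hu' : 1 + mu * u ≠ 0)
    (hv' : 1 + mu * v ≠ 0) (hw' : 1 + mu * w ≠ 0)
    (hcharu : lam + lam' = lam / (1 + mu * u) + lam' / (1 - mu' * u))
    (hcharv : lam + lam' + d * v = lam / (1 + mu * v) + lam' / (1 - mu' * v))
    (hcharw : lam + lam' + d * w = lam / (1 + mu * w) + lam' / (1 - mu' * w))
    (hcont : twoExp C4 0 C5 u b = twoExp C7 v C8 w b)
    (hclaim : C4 + C5 / (1 + mu * u) = 1)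
    (hpremium : twoExp C4 0 (C5 / (1 - mu' * u)) u b
      = twoExp (C7 / (1 - mu' * v)) v (C8 / (1 - mu' * w)) w b)
    (hhigh : Real.exp (-(mu⁻¹ * b)) + C4 * (1 - Real.exp (-(mu⁻¹ * b)))
          + C5 / (1 + mu * u) * (Real.exp (u * b) - Real.exp (-(mu⁻¹ * b)))
          = twoExp (C7 / (1 + mu * v)) v (C8 / (1 + mu * w)) w b)
    (hx : 0 ≤ x) :
    ∫ z, candidate b u v w C4 C5 C7 C8 z ∂(chain lam lam' mu mu' b d x)
      = candidate b u v w C4 C5 C7 C8 x := by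
  have hL : 0 < lam + lam' := by positivity
  have := isProbabilityMeasure_expMeasure hL
  have := isProbabilityMeasure_jumpLaw hlam hlam' hmu hmu'
  have hint := integrable_candidate (b := b) (C4 := C4) (C5 := C5) (C7 := C7) (C8 := C8)
    (μ := (expMeasure (lam + lam')).prod (jumpLaw lam lam' mu mu')) hu hv hw
    (measurable_level_add b d x)
  have hlow : ∀ z, 0 ≤ z → z ≤ b →
      ∫ j, candidate b u v w C4 C5 C7 C8 (z + j) ∂(jumpLaw lam lam' mu mu')
        = twoExp C4 0 C5 u z := fun z hz hzb =>
    integral_jumpLaw_low hlam hlam' hmu hmu' hb hu hv hw hu' hcharu hcont hclaim hpremium hz hzb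
  rw [chain, integral_map (measurable_level_add b d x).aemeasurable
    measurable_candidate.aestronglyMeasurable, integral_prod _ hint]
  rcases le_total x b with hxb | hxb
  · simp_rw [level_of_le hd hxb]
    rw [hlow x hx hxb, candidate_of_le hx hxb, integral_const, probReal_univ, one_smul]
  · have hc : 0 ≤ (x - b) / d := div_nonneg (by linarith) hd.le
    rw [integral_expMeasure_split hL.le hint.integral_prod_left hc,
      integral_congr_Ioc (g := fun t => Real.exp (-((lam + lam') * t))
        * twoExp (C7 * (lam + lam' + d * v)) v (C8 * (lam + lam' + d * w)) w (x - d * t)) hc,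
      integral_exp_mul_twoExp,
      setIntegral_congr_fun (g := fun t => Real.exp (-((lam + lam') * t))
        * twoExp (twoExp C4 0 C5 u b * (lam + lam' + 0 * 0)) 0 (0 * (lam + lam' + 0 * 0)) 0
          (x - 0 * t)) measurableSet_Ioi,
      integral_Ioi_exp_mul_twoExp (by simpa using hL) (by simpa using hL),
      candidate_of_ge hb hcont hxb, hcont]
    · have hxc : x - d * ((x - b) / d) = b := by
        rw [mul_div_cancel₀ _ hd.ne']; ring
      have hone : ∀ D, twoExp D 0 0 0 (x - 0 * ((x - b) / d)) = D := fun D => by simp [twoExp]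
      rw [hxc, hone, mul_zero, neg_zero, Real.exp_zero, mul_zero, sub_zero]
      ring
    · intro t ht
      have hlev : level b d x t = b := by
        rw [level, min_eq_right (le_of_lt ht), max_eq_right hc, mul_div_cancel₀ _ hd.ne']; ring
      simp only [hlev]
      rw [hlow b hb le_rfl]
      simp [twoExp, mul_comm]
    · intro t ht
      have hlev : level b d x t = x - d * t := by
        rw [level, min_eq_left ht.2, max_eq_right ht.1.le]
      have htb : b ≤ x - d * t := by
        have := (le_div_iff₀ hd).1 ht.2
        linarith
      simp only [hlev]
      rw [integral_jumpLaw_high hlam hlam' hmu hmu' hb hu hv hw hu' hv' hw' hcharv hcharw hcont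
        hhigh htb]

end Harmonic

/-! ### Meaning of the linear system -/

section System

variable {lam lam' mu mu' b d u v w : ℝ} {C : Fin 4 → ℝ}

/-- The second row cancels the boundary term at ruin, and the third is continuity at `b`. The first,
after a multiple of the second is subtracted, matches premiums across `b`. The fourth, through the
characteristic equations of `v` and `w`, matches claims across `b`. -/
lemma system_equations (hlam : 0 < lam) (hlam' : 0 < lam') (hmu : 0 < mu) (hmu' : 0 < mu')
    (hu1 : lam / (1 + mu * u) = mu' * (lam + lam') / (mu + mu'))
    (hu2 : lam' / (1 - mu' * u) = mu * (lam + lam') / (mu + mu'))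
    (hcharv : lam + lam' + d * v = lam / (1 + mu * v) + lam' / (1 - mu' * v))
    (hcharw : lam + lam' + d * w = lam / (1 + mu * w) + lam' / (1 - mu' * w))
    (hC : (coeffMatrix lam lam' mu mu' b d u v w).mulVec C = systemRHS lam mu mu' b) :
    twoExp (C 0) 0 (C 1) u b = twoExp (C 2) v (C 3) w b ∧
    C 0 + C 1 / (1 + mu * u) = 1 ∧
    twoExp (C 0) 0 (C 1 / (1 - mu' * u)) u b
      = twoExp (C 2 / (1 - mu' * v)) v (C 3 / (1 - mu' * w)) w b ∧
    Real.exp (-(mu⁻¹ * b)) + C 0 * (1 - Real.exp (-(mu⁻¹ * b)))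
          + C 1 / (1 + mu * u) * (Real.exp (u * b) - Real.exp (-(mu⁻¹ * b)))
          = twoExp (C 2 / (1 + mu * v)) v (C 3 / (1 + mu * w)) w b := by
  have hneg : ∀ z X : ℝ, X / (mu' * z - 1) = -(X / (1 - mu' * z)) := fun z X => by
    rw [← div_neg]; congr 1; ring
  have hG : Real.exp (-b / mu) = Real.exp (-(mu⁻¹ * b)) := by congr 1; field_simp
  have e0 := congrFun hC 0
  have e1 := congrFun hC 1
  have e2 := congrFun hC 2
  have e3 := congrFun hC 3
  simp only [coeffMatrix, systemRHS, Matrix.mulVec, dotProduct, Fin.sum_univ_four, Matrix.of_apply,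
    Matrix.cons_val', Matrix.cons_val_zero, Matrix.cons_val_one, Matrix.cons_val,
    Matrix.cons_val_fin_one, hG, hneg] at e0 e1 e2 e3
  set M := mu + mu' with hM
  have hM0 : M ≠ 0 := by positivity
  have hE := (Real.exp_pos (b / mu')).ne'
  have h1 : C 0 + C 1 / (1 + mu * u) = 1 := by
    have h : lam * (C 0 + C 1 / (1 + mu * u)) = lam * 1 := by
      have : lam * (C 0 + C 1 / (1 + mu * u)) = lam * C 0 + C 1 * (lam / (1 + mu * u)) := by ring
      rw [this, hu1]
      have h2 : lam * (1 + mu' / mu) * C 0 + mu' * (lam + lam') / mu * C 1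
          = lam * (1 + mu' / mu) := by linear_combination e1
      have h3 : (1 + mu' / mu) = M / mu := by rw [hM]; field_simp
      rw [h3] at h2
      field_simp at h2 ⊢
      linear_combination h2
    exact mul_left_cancel₀ hlam.ne' h
  have h1' : lam * C 0 + mu' * (lam + lam') / M * C 1 = lam := by
    rw [← hu1]; linear_combination lam * h1
  refine ⟨?_, h1, ?_, ?_⟩
  · simp only [twoExp, zero_mul, Real.exp_zero]
    linear_combination e2
  · refine mul_left_cancel₀ hlam'.ne' ?_
    have e0' : lam' * C 0 + mu * (lam + lam') / M * Real.exp (u * b) * C 1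
        = lam' * Real.exp (v * b) / (1 - mu' * v) * C 2
          + lam' * Real.exp (w * b) / (1 - mu' * w) * C 3 := by
      linear_combination e0 - Real.exp (b / mu') * h1'
    rw [← hu2] at e0'
    simp only [twoExp, zero_mul, Real.exp_zero]
    linear_combination e0'
  · refine mul_left_cancel₀ hlam.ne' ?_
    rw [hcharv, hcharw, ← hu1] at e3
    simp only [twoExp]
    linear_combination -e3

end System

end ThresholdRisk

theorem theorem4 {Ω : Type*} [MeasurableSpace Ω] (P : MeasureTheory.Measure Ω)
    [MeasureTheory.IsProbabilityMeasure P]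
    (lam lam' mu mu' b d : ℝ)
    (hlam : 0 < lam) (hlam' : 0 < lam') (hmu : 0 < mu) (hmu' : 0 < mu') (hb : 0 < b) (hd : 0 < d)
    (hdrift : lam * mu + d < lam' * mu')
    (T Y T' Y' : ℕ → Ω → ℝ) (X : ℝ → ℝ → Ω → ℝ)
    (hX : ThresholdRisk.IsModel P lam lam' mu mu' b d T Y T' Y' X) :
    0 < ThresholdRisk.disc lam lam' mu mu' d ∧
    ThresholdRisk.z5 lam lam' mu mu' < 0 ∧
    ThresholdRisk.z7 lam lam' mu mu' d < 0 ∧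
    ThresholdRisk.z8 lam lam' mu mu' d < 0 ∧
    0 < (ThresholdRisk.systemMatrix lam lam' mu mu' b d).det ∧
    ∃ C4 C5 C7 C8 : ℝ,
      (∀ C : Fin 4 → ℝ,
        (ThresholdRisk.systemMatrix lam lam' mu mu' b d).mulVec C
            = ThresholdRisk.systemRHS lam mu mu' b
          ↔ C = ![C4, C5, C7, C8]) ∧
      (∀ x : ℝ, 0 ≤ x → x ≤ b →
        ThresholdRisk.ruinProbability P (X x)
          = C4 + C5 * Real.exp (ThresholdRisk.z5 lam lam' mu mu' * x)) ∧
      (∀ x : ℝ, b ≤ x →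
        ThresholdRisk.ruinProbability P (X x)
          = C7 * Real.exp (ThresholdRisk.z7 lam lam' mu mu' d * x)
            + C8 * Real.exp (ThresholdRisk.z8 lam lam' mu mu' d * x)) := by
  open ThresholdRisk in
  have hz5 := z5_neg hlam hlam' hmu hmu' hd hdrift
  have hz7 := z7_neg hlam hmu hmu' hd hdrift
  have hz8 := (z8_lt_z7 (lam' := lam') hlam hmu hmu' hd).trans hz7
  have hdet := det_systemMatrix_pos hlam hlam' hmu hmu' hb hd hdrift
  refine ⟨disc_pos hlam hmu hmu' hd, hz5, hz7, hz8, hdet, ?_⟩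
  have hunit : IsUnit (systemMatrix lam lam' mu mu' b d).det := hdet.ne'.isUnit
  set C := (systemMatrix lam lam' mu mu' b d)⁻¹.mulVec (systemRHS lam mu mu' b) with hCdef
  have hC : (systemMatrix lam lam' mu mu' b d).mulVec C = systemRHS lam mu mu' b := by
    rw [hCdef, Matrix.mulVec_mulVec, Matrix.mul_nonsing_inv _ hunit, Matrix.one_mulVec]
  have hroot7 := z7_root (lam' := lam') hlam hmu hmu' hd
  have hroot8 := z8_root (lam' := lam') hlam hmu hmu' hd
  have hchar7 := characteristic_eq hlam hmu hmu' hz7 hroot7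
  have hchar8 := characteristic_eq hlam hmu hmu' hz8 hroot8
  have hclaim5 : 1 + mu * z5 lam lam' mu mu' = lam * (mu + mu') / (mu' * (lam + lam')) := by
    unfold z5; field_simp; ring
  have hprem5 : 1 - mu' * z5 lam lam' mu mu' = lam' * (mu + mu') / (mu * (lam + lam')) := by
    unfold z5; field_simp; ring
  have hne5 : 1 + mu * z5 lam lam' mu mu' ≠ 0 := by rw [hclaim5]; positivity
  have hu1 : lam / (1 + mu * z5 lam lam' mu mu') = mu' * (lam + lam') / (mu + mu') := by
    rw [hclaim5]; field_simp
  have hu2 : lam' / (1 - mu' * z5 lam lam' mu mu') = mu * (lam + lam') / (mu + mu') := by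
    rw [hprem5]; field_simp
  -- `z5` is the nonzero root of the characteristic equation without the dividend term.
  have hchar5 : lam + lam' = lam / (1 + mu * z5 lam lam' mu mu')
      + lam' / (1 - mu' * z5 lam lam' mu mu') := by
    rw [hu1, hu2]; field_simp; ring
  obtain ⟨hcont, hclaim, hpremium, hhigh⟩ :=
    system_equations hlam hlam' hmu hmu' hu1 hu2 hchar7 hchar8 hC
  have hruin : ∀ x, 0 ≤ x → ruinProbability P (X x)
      = candidate b (z5 lam lam' mu mu') (z7 lam lam' mu mu' d) (z8 lam lam' mu mu' d)
          (C 0) (C 1) (C 2) (C 3) x := fun x hx => by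
    rw [hX.ruinProbability_eq hlam hlam' hmu hmu' hb.le hd hx]
    exact ruin_eq_of_harmonic hlam hlam' hmu hmu' hd measurable_candidate
      (abs_candidate_le hz5.le hz7.le hz8.le) (fun x hx => candidate_of_neg hx)
      (fun x hx => candidate_harmonic hlam hlam' hmu hmu' hb.le hd hz5.le hz7.le hz8.le hne5
        (one_add_mu_mul_ne_zero hlam hmu hmu' hroot7) (one_add_mu_mul_ne_zero hlam hmu hmu' hroot8)
        hchar5 hchar7 hchar8 hcont hclaim hpremium hhigh hx)
      (tendsto_candidate hb.le hz7 hz8)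
  refine ⟨C 0, C 1, C 2, C 3, fun C' => ?_, fun x hx hxb => ?_, fun x hxb => ?_⟩
  · have hCvec : ![C 0, C 1, C 2, C 3] = C := by
      ext i; fin_cases i <;> rfl
    rw [hCvec]
    constructor
    · intro h
      rw [hCdef, ← h, Matrix.mulVec_mulVec, Matrix.nonsing_inv_mul _ hunit, Matrix.one_mulVec]
    · rintro rfl
      exact hC
  · rw [hruin x hx, candidate_of_le hx hxb]
    simp [twoExp]
  · rw [hruin x (hb.le.trans hxb), candidate_of_ge hb.le hcont hxb, twoExp]
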